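/- Let $\mathbb F$ be a field of characteristic zero. Let $O$ be the Onsager Lie algebra over $\mathbb F$, i.e. the Lie algebra with generators $A,B$ and relations $[A,[A,[A,B]]]=4[A,B]$ and $[B,[B,[B,A]]]=4[B,A]$. Let $\boxtimes$ be the tetrahedron algebra, i.e. the Lie algebra over $\mathbb F$ with generators $x_{ij}$ ($i,j\in\{0,1,2,3\}$, $i\neq j$) and relations $x_{ij}+x_{ji}=0$ ($i,j$ distinct), $[x_{ij},x_{jk}]=2x_{ij}+2x_{jk}$ ($i,j,k$ mutually distinct), and $[x_{ij},[x_{ij},[x_{ij},x_{kh}]]]=4[x_{ij},x_{kh}]$ ($h,i,j,k$ mutually distinct). An element $\xi\in\boxtimes$ is called $x_{ij}$-like if $[x_{ij},\xi]=0$ and $[x_{kh},[x_{kh},[x_{kh},\xi]]]=4[x_{kh},\xi]$, where $h,i,j,k$ are mutually distinct. Let $\mathcal A=\mathbb F[t,t^{-1},(t-1)^{-1}]$, $t'=1-t^{-1}$, $t''=(1-t)^{-1}$. Let $e,f,h$ be the usual basis of $\mathfrak{sl}_2$ ($[h,e]=2e$, $[h,f]=-2f$, $[e,f]=h$), let $x=2e-h$,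 $y=-2f-h$, $z=h$, and let $L(\mathfrak{sl}_2)^+=\mathfrak{sl}_2\otimes\mathcal A$ with bracket $[u\otimes a,v\otimes b]=[u,v]\otimes ab$, on which $\mathcal A$ acts by $(u\otimes a)b=u\otimes ab$. Let $\sigma:\boxtimes\to L(\mathfrak{sl}_2)^+$ be the Lie algebra homomorphism with $x_{12}\mapsto x\otimes1$, $x_{23}\mapsto y\otimes 1$, $x_{31}\mapsto z\otimes 1$, $x_{03}\mapsto y\otimes t+z\otimes(t-1)$, $x_{01}\mapsto z\otimes t'+x\otimes(t'-1)$, $x_{02}\mapsto x\otimes t''+y\otimes(t''-1)$, and let $\iota:O\to\boxtimes$ be the Lie algebra homomorphism with $A\mapsto x_{12}$, $B\mapsto x_{03}$. For $i\in\mathbb N=\{0,1,2,\dots\}$ define elements of $L(\mathfrak{sl}_2)^+$ by $$A^{\uparrow\downarrow}_i=x\otimes(-t)^i,\qquad B^{\uparrow\downarrow}_i=(-y\otimes t-z\otimes(t-1))(-t)^i,\qquad \psi^{\uparrow\downarrow}_i=(x\otimes 1-z\otimes(t-1))(-t)^{i-1}.$$ Then $\sigma\circ\iota:O\to L(\mathfrak{sl}_2)^+$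 is injective, and, identifying $O$ with its image under $\sigma\circ\iota$ (so that $A=x\otimes 1$ and $B=y\otimes t+z\otimes(t-1)$), the elements $$A^{\uparrow\downarrow}_i,\qquad B^{\uparrow\downarrow}_i,\qquad \psi^{\uparrow\downarrow}_{i+1}\qquad(i\in\mathbb N)$$ form a basis of the vector space $O$, with $A^{\uparrow\downarrow}_0=A$ and $B^{\uparrow\downarrow}_0=-B$. Regarded via $\iota$ as elements of $\boxtimes$, the basis vectors $A^{\uparrow\downarrow}_i$, $B^{\uparrow\downarrow}_i$, $\psi^{\uparrow\downarrow}_{i+1}$ are $x_{12}$-like, $x_{30}$-like and $x_{01}$-like, respectively. Moreover, for all $i,j\in\mathbb N$, $$[A^{\uparrow\downarrow}_i,A^{\uparrow\downarrow}_j]=0,\qquad [B^{\uparrow\downarrow}_i,B^{\uparrow\downarrow}_j]=0,\qquad [\psi^{\uparrow\downarrow}_i,\psi^{\uparrow\downarrow}_j]=0,$$ $$[\psi^{\uparrow\downarrow}_i,A^{\uparrow\downarrow}_j]=2\psi^{\uparrow\downarrow}_{i+j}+2A^{\uparrow\downarrow}_{i+j},\qquad [B^{\uparrow\downarrow}_i,\psi^{\uparrow\downarrow}_j]=2B^{\uparrow\downarrow}_{i+j}+2\psi^{\uparrow\downarrow}_{i+j},$$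 $$[A^{\uparrow\downarrow}_i,B^{\uparrow\downarrow}_j]=2A^{\uparrow\downarrow}_{i+j}+2B^{\uparrow\downarrow}_{i+j}-4\psi^{\uparrow\downarrow}_{i+j+1}.$$ -/

import Mathlib

open scoped TensorProduct Polynomial

noncomputable section

namespace Onsager

/-! ### Lie algebras given by generators and relations -/

section Presentation

variable (F : Type*) [Field F] {X : Type*}

/-- The Lie algebra over `F` with generators `X`, subject to the relations `r = 0` for `r ∈ rels`:
the free Lie algebra modulo the ideal generated by `rels`. -/
def PresentedLie (rels : Set (FreeLieAlgebra F X)) : Type _ :=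
  FreeLieAlgebra F X ⧸ LieSubmodule.lieSpan F (FreeLieAlgebra F X) rels

instance (rels : Set (FreeLieAlgebra F X)) : LieRing (PresentedLie F rels) :=
  inferInstanceAs (LieRing (FreeLieAlgebra F X ⧸ LieSubmodule.lieSpan F (FreeLieAlgebra F X) rels))

instance (rels : Set (FreeLieAlgebra F X)) : LieAlgebra F (PresentedLie F rels) :=
  inferInstanceAs
    (LieAlgebra F (FreeLieAlgebra F X ⧸ LieSubmodule.lieSpan F (FreeLieAlgebra F X) rels))

variable {F}

/-- The quotient homomorphism. -/
def PresentedLie.mk (rels : Set (FreeLieAlgebra F X)) : FreeLieAlgebra F X →ₗ⁅F⁆ PresentedLie F rels :=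
  { (LieSubmodule.lieSpan F (FreeLieAlgebra F X) rels).toSubmodule.mkQ with
    map_lie' := fun {_ _} => rfl }

theorem PresentedLie.mk_eq_zero {rels : Set (FreeLieAlgebra F X)} {r : FreeLieAlgebra F X}
    (hr : r ∈ rels) : PresentedLie.mk rels r = 0 :=
  LieSubmodule.Quotient.mk_eq_zero'.2 (LieSubmodule.subset_lieSpan hr)

theorem PresentedLie.mk_surjective (rels : Set (FreeLieAlgebra F X)) :
    Function.Surjective (PresentedLie.mk rels) :=
  Submodule.mkQ_surjective _

/-- The image of a generator. -/
def PresentedLie.gen (rels : Set (FreeLieAlgebra F X)) (a : X) : PresentedLie F rels :=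
  PresentedLie.mk rels (FreeLieAlgebra.of F a)

/-- The universal property: a map on generators that respects the relations extends to a Lie algebra
homomorphism. -/
def PresentedLie.lift (rels : Set (FreeLieAlgebra F X)) {L : Type*} [LieRing L] [LieAlgebra F L]
    (f : X → L) (hf : ∀ r ∈ rels, FreeLieAlgebra.lift F f r = 0) :
    PresentedLie F rels →ₗ⁅F⁆ L :=
  { (LieSubmodule.lieSpan F (FreeLieAlgebra F X) rels).toSubmodule.liftQ
      (FreeLieAlgebra.lift F f : FreeLieAlgebra F X →ₗ[F] L)
      (by
        have h : LieSubmodule.lieSpan F (FreeLieAlgebra F X) rels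
            ≤ (FreeLieAlgebra.lift F f).ker := by
          rw [LieSubmodule.lieSpan_le]
          intro r hr
          exact LieHom.mem_ker.2 (hf r hr)
        intro x hx
        exact LieHom.mem_ker.1 (h hx)) with
    map_lie' := by
      intro x y
      obtain ⟨x, rfl⟩ := PresentedLie.mk_surjective rels x
      obtain ⟨y, rfl⟩ := PresentedLie.mk_surjective rels y
      exact LieHom.map_lie (FreeLieAlgebra.lift F f) x y }

theorem PresentedLie.lift_gen (rels : Set (FreeLieAlgebra F X)) {L : Type*} [LieRing L]
    [LieAlgebra F L] (f : X → L) (hf : ∀ r ∈ rels, FreeLieAlgebra.lift F f r = 0) (a : X) :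
    PresentedLie.lift rels f hf (PresentedLie.gen rels a) = f a :=
  FreeLieAlgebra.lift_of_apply f a

end Presentation

variable (F : Type*) [Field F]

/-! ### The Onsager Lie algebra -/

/-- The Dolan–Grady relations in the generators `A = of 0`, `B = of 1`. -/
inductive DolanGrady : FreeLieAlgebra F (Fin 2) → Prop
  | rel_A : DolanGrady
      (⁅FreeLieAlgebra.of F (0 : Fin 2), ⁅FreeLieAlgebra.of F (0 : Fin 2),
          ⁅FreeLieAlgebra.of F (0 : Fin 2), FreeLieAlgebra.of F (1 : Fin 2)⁆⁆⁆
        - (4 : F) • ⁅FreeLieAlgebra.of F (0 : Fin 2), FreeLieAlgebra.of F (1 : Fin 2)⁆)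
  | rel_B : DolanGrady
      (⁅FreeLieAlgebra.of F (1 : Fin 2), ⁅FreeLieAlgebra.of F (1 : Fin 2),
          ⁅FreeLieAlgebra.of F (1 : Fin 2), FreeLieAlgebra.of F (0 : Fin 2)⁆⁆⁆
        - (4 : F) • ⁅FreeLieAlgebra.of F (1 : Fin 2), FreeLieAlgebra.of F (0 : Fin 2)⁆)

/-- The Onsager Lie algebra `O`. -/
abbrev O : Type _ := PresentedLie F {r | DolanGrady F r}

/-- The standard generator `A` of `O`. -/
def genA : O F := PresentedLie.gen _ 0

/-- The standard generator `B` of `O`. -/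
def genB : O F := PresentedLie.gen _ 1

/-! ### The tetrahedron algebra -/

/-- Index set of the standard generators: ordered pairs of distinct elements of `{0, 1, 2, 3}`. -/
abbrev TetIndex : Type := {p : Fin 4 × Fin 4 // p.1 ≠ p.2}

/-- The generator `x_ij` in the free Lie algebra. -/
def freeX (i j : Fin 4) (h : i ≠ j) : FreeLieAlgebra F TetIndex := FreeLieAlgebra.of F ⟨(i, j), h⟩

/-- The defining relations of the tetrahedron algebra. -/
inductive TetRel : FreeLieAlgebra F TetIndex → Prop
  | skew (i j : Fin 4) (hij : i ≠ j) : TetRel (freeX F i j hij + freeX F j i hij.symm)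
  | triple (i j k : Fin 4) (hij : i ≠ j) (hjk : j ≠ k) (hik : i ≠ k) : TetRel
      (⁅freeX F i j hij, freeX F j k hjk⁆
        - ((2 : F) • freeX F i j hij + (2 : F) • freeX F j k hjk))
  | dolanGrady (h i j k : Fin 4) (hhi : h ≠ i) (hhj : h ≠ j) (hij : i ≠ j) (hik : i ≠ k)
      (hjk : j ≠ k) (hkh : k ≠ h) : TetRel
      (⁅freeX F i j hij, ⁅freeX F i j hij, ⁅freeX F i j hij, freeX F k h hkh⁆⁆⁆
        - (4 : F) • ⁅freeX F i j hij, freeX F k h hkh⁆)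

/-- The tetrahedron algebra. -/
abbrev Tet : Type _ := PresentedLie F {r | TetRel F r}

/-- The standard generator `x_ij` of the tetrahedron algebra. -/
def x (i j : Fin 4) (h : i ≠ j) : Tet F := PresentedLie.gen _ ⟨(i, j), h⟩

theorem tet_dolanGrady (h i j k : Fin 4) (hhi : h ≠ i) (hhj : h ≠ j) (hij : i ≠ j) (hik : i ≠ k)
    (hjk : j ≠ k) (hkh : k ≠ h) :
    ⁅x F i j hij, ⁅x F i j hij, ⁅x F i j hij, x F k h hkh⁆⁆⁆
      = (4 : F) • ⁅x F i j hij, x F k h hkh⁆ :=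
  sub_eq_zero.1 (by
    have := PresentedLie.mk_eq_zero
      (show _ ∈ {r | TetRel F r} from TetRel.dolanGrady h i j k hhi hhj hij hik hjk hkh)
    simp only [map_sub, map_smul, LieHom.map_lie] at this
    exact this)

variable {F} in
/-- `ξ` is `x_ij`-like: it commutes with `x_ij`, and
`[x_kh, [x_kh, [x_kh, ξ]]] = 4 [x_kh, ξ]`, where `h, i, j, k` are mutually distinct. -/
def IsLike (i j : Fin 4) (hij : i ≠ j) (ξ : Tet F) : Prop :=
  ⁅x F i j hij, ξ⁆ = 0 ∧
    ∀ (h k : Fin 4) (hkh : k ≠ h), h ≠ i → h ≠ j → k ≠ i → k ≠ j →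
      ⁅x F k h hkh, ⁅x F k h hkh, ⁅x F k h hkh, ξ⁆⁆⁆ = (4 : F) • ⁅x F k h hkh, ξ⁆

/-- The homomorphism from `O` to the tetrahedron algebra with `A ↦ x_12`, `B ↦ x_03`. -/
def toTet : O F →ₗ⁅F⁆ Tet F :=
  PresentedLie.lift _ ![x F 1 2 (by decide), x F 0 3 (by decide)] (by
    rintro r (_ | _)
    · simp only [map_sub, map_smul, LieHom.map_lie, FreeLieAlgebra.lift_of_apply]
      exact sub_eq_zero.2 (tet_dolanGrady F 3 1 2 0 (by decide) (by decide) (by decide)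
        (by decide) (by decide) (by decide))
    · simp only [map_sub, map_smul, LieHom.map_lie, FreeLieAlgebra.lift_of_apply]
      exact sub_eq_zero.2 (tet_dolanGrady F 2 0 3 1 (by decide) (by decide) (by decide)
        (by decide) (by decide) (by decide)))

theorem toTet_genA : toTet F (genA F) = x F 1 2 (by decide) := PresentedLie.lift_gen _ _ _ _

theorem toTet_genB : toTet F (genB F) = x F 0 3 (by decide) := PresentedLie.lift_gen _ _ _ _

/-! ### The three-point `sl₂` loop algebra -/

/-- The Lie algebra `sl₂` of trace-zero `2 × 2` matrices. -/
abbrev Sl2 : Type _ := LieAlgebra.SpecialLinear.sl (Fin 2) F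

/-- `e = E₁₂`. -/
def e : Sl2 F := LieAlgebra.SpecialLinear.single 0 1 (by decide) 1

/-- `f = E₂₁`. -/
def f : Sl2 F := LieAlgebra.SpecialLinear.single 1 0 (by decide) 1

/-- `h = E₁₁ - E₂₂`. -/
def h : Sl2 F := LieAlgebra.SpecialLinear.singleSubSingle 0 1 1

/-- The element `x = 2e - h` of the equitable basis of `sl₂`. -/
def eqX : Sl2 F := (2 : F) • e F - h F

/-- The element `y = -2f - h` of the equitable basis of `sl₂`. -/
def eqY : Sl2 F := -((2 : F) • f F) - h F

/-- The element `z = h` of the equitable basis of `sl₂`. -/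
def eqZ : Sl2 F := h F

theorem lie_eqX_eqY : ⁅eqX F, eqY F⁆ = (2 : F) • eqX F + (2 : F) • eqY F := by
  apply Subtype.ext
  rw [LieAlgebra.SpecialLinear.sl_bracket]
  ext i j
  fin_cases i <;> fin_cases j <;>
    simp [eqX, eqY, e, f, h, Matrix.mul_apply, Fin.sum_univ_two, Matrix.single_apply] <;> ring

theorem lie_eqY_eqZ : ⁅eqY F, eqZ F⁆ = (2 : F) • eqY F + (2 : F) • eqZ F := by
  apply Subtype.ext
  rw [LieAlgebra.SpecialLinear.sl_bracket]
  ext i j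
  fin_cases i <;> fin_cases j <;>
    simp [eqZ, eqY, f, h, Matrix.mul_apply, Matrix.single_apply]
  all_goals ring

theorem lie_eqZ_eqX : ⁅eqZ F, eqX F⁆ = (2 : F) • eqZ F + (2 : F) • eqX F := by
  apply Subtype.ext
  rw [LieAlgebra.SpecialLinear.sl_bracket]
  ext i j
  fin_cases i <;> fin_cases j <;>
    simp [eqZ, eqX, e, h, Matrix.mul_apply, Matrix.single_apply]
  all_goals ring

/-- The algebra `𝒜 = F[t, t⁻¹, (t - 1)⁻¹]`. -/
def LoopRing : Type _ := Localization.Away (Polynomial.X * (Polynomial.X - 1) : F[X])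

instance : CommRing (LoopRing F) :=
  inferInstanceAs (CommRing (Localization.Away (Polynomial.X * (Polynomial.X - 1) : F[X])))

instance : Algebra F[X] (LoopRing F) :=
  inferInstanceAs (Algebra F[X] (Localization.Away (Polynomial.X * (Polynomial.X - 1) : F[X])))

instance : Algebra F (LoopRing F) :=
  inferInstanceAs (Algebra F (Localization.Away (Polynomial.X * (Polynomial.X - 1) : F[X])))

instance : IsScalarTower F F[X] (LoopRing F) :=
  inferInstanceAs
    (IsScalarTower F F[X] (Localization.Away (Polynomial.X * (Polynomial.X - 1) : F[X])))

instance : IsLocalization.Away (Polynomial.X * (Polynomial.X - 1) : F[X]) (LoopRing F) :=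
  inferInstanceAs (IsLocalization.Away (Polynomial.X * (Polynomial.X - 1) : F[X])
    (Localization.Away (Polynomial.X * (Polynomial.X - 1) : F[X])))

theorem isUnit_mul :
    IsUnit (algebraMap F[X] (LoopRing F) (Polynomial.X * (Polynomial.X - 1))) :=
  IsLocalization.Away.algebraMap_isUnit _

/-- The unit `t` of `𝒜`. -/
def t : (LoopRing F)ˣ :=
  IsUnit.unit (a := algebraMap F[X] (LoopRing F) Polynomial.X)
    (isUnit_of_mul_isUnit_left (by rw [← map_mul]; exact isUnit_mul F))

theorem isUnit_one_sub_t : IsUnit (1 - (t F : LoopRing F)) := by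
  have h : IsUnit (algebraMap F[X] (LoopRing F) (Polynomial.X - 1)) :=
    isUnit_of_mul_isUnit_right (by rw [← map_mul]; exact isUnit_mul F)
  have h2 : 1 - (t F : LoopRing F) = -algebraMap F[X] (LoopRing F) (Polynomial.X - 1) := by
    simp [t]
  rw [h2]
  exact h.neg

/-- `t' = 1 - t⁻¹`. -/
def tPrime : LoopRing F := 1 - (↑(t F)⁻¹ : LoopRing F)

/-- `t'' = (1 - t)⁻¹`. -/
def tDouble : LoopRing F := ↑(isUnit_one_sub_t F).unit⁻¹

/-- The three-point `sl₂` loop algebra `sl₂ ⊗ 𝒜`, with the bracket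
`[u ⊗ a, v ⊗ b] = [u, v] ⊗ ab` of Mathlib's extension of scalars (where the factor `𝒜` is written
on the left). -/
def Loop : Type _ := LoopRing F ⊗[F] Sl2 F

instance : LieRing (Loop F) := inferInstanceAs (LieRing (LoopRing F ⊗[F] Sl2 F))

instance : LieAlgebra F (Loop F) := inferInstanceAs (LieAlgebra F (LoopRing F ⊗[F] Sl2 F))

instance : LieAlgebra (LoopRing F) (Loop F) :=
  inferInstanceAs (LieAlgebra (LoopRing F) (LoopRing F ⊗[F] Sl2 F))

instance : IsScalarTower F (LoopRing F) (Loop F) :=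
  inferInstanceAs (IsScalarTower F (LoopRing F) (LoopRing F ⊗[F] Sl2 F))

variable {F} in
/-- The element `u ⊗ a` of the loop algebra. -/
def tens (u : Sl2 F) (a : LoopRing F) : Loop F := a ⊗ₜ[F] u

theorem lie_tens (u v : Sl2 F) (a b : LoopRing F) :
    ⁅tens u a, tens v b⁆ = tens ⁅u, v⁆ (a * b) := rfl

theorem tens_add (u v : Sl2 F) (a : LoopRing F) : tens (u + v) a = tens u a + tens v a :=
  TensorProduct.tmul_add a u v

theorem tens_neg (u : Sl2 F) (a : LoopRing F) : tens (-u) a = -tens u a :=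
  TensorProduct.tmul_neg a u

theorem tens_zero (a : LoopRing F) : tens (0 : Sl2 F) a = 0 := TensorProduct.tmul_zero _ a

theorem tens_smul (r : F) (u : Sl2 F) (a : LoopRing F) : tens (r • u) a = r • tens u a :=
  TensorProduct.tmul_smul r a u

theorem smul_tens (b : LoopRing F) (u : Sl2 F) (a : LoopRing F) : b • tens u a = tens u (b * a) :=
  rfl

theorem tens_eq (u : Sl2 F) (a : LoopRing F) : tens u a = a • tens u 1 := by
  rw [smul_tens, mul_one]

/-- The elements `x_12^σ, x_03^σ, x_23^σ, x_01^σ, x_31^σ, x_02^σ` and their negatives. -/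
def loopGen : Fin 4 → Fin 4 → Loop F
  | 1, 2 => tens (eqX F) 1
  | 2, 3 => tens (eqY F) 1
  | 3, 1 => tens (eqZ F) 1
  | 0, 3 => tens (eqY F) (t F) + tens (eqZ F) (t F - 1)
  | 0, 1 => tens (eqZ F) (tPrime F) + tens (eqX F) (tPrime F - 1)
  | 0, 2 => tens (eqX F) (tDouble F) + tens (eqY F) (tDouble F - 1)
  | 2, 1 => -tens (eqX F) 1
  | 3, 2 => -tens (eqY F) 1
  | 1, 3 => -tens (eqZ F) 1
  | 3, 0 => -(tens (eqY F) (t F) + tens (eqZ F) (t F - 1))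
  | 1, 0 => -(tens (eqZ F) (tPrime F) + tens (eqX F) (tPrime F - 1))
  | 2, 0 => -(tens (eqX F) (tDouble F) + tens (eqY F) (tDouble F - 1))
  | _, _ => 0

/-- Auxiliary: the element `x ⊗ a + y ⊗ b + z ⊗ c`. -/
def comb (a b c : LoopRing F) : Loop F := tens (eqX F) a + tens (eqY F) b + tens (eqZ F) c

theorem lie_comb (a b c a' b' c' : LoopRing F) :
    ⁅comb F a b c, comb F a' b' c'⁆ =
      comb F (2 * (a * b' - b * a') + 2 * (c * a' - a * c'))
        (2 * (a * b' - b * a') + 2 * (b * c' - c * b'))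
        (2 * (b * c' - c * b') + 2 * (c * a' - a * c')) := by
  have h1 : ⁅eqY F, eqX F⁆ = -((2 : F) • eqX F + (2 : F) • eqY F) := by
    rw [← lie_eqX_eqY, lie_skew]
  have h2 : ⁅eqZ F, eqY F⁆ = -((2 : F) • eqY F + (2 : F) • eqZ F) := by
    rw [← lie_eqY_eqZ, lie_skew]
  have h3 : ⁅eqX F, eqZ F⁆ = -((2 : F) • eqZ F + (2 : F) • eqX F) := by
    rw [← lie_eqZ_eqX, lie_skew]
  have h5 : ∀ (a : LoopRing F) (u : Sl2 F), (2 : F) • tens u a = (2 * a) • tens u 1 := by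
    intro a u
    rw [two_smul, two_mul, add_smul, ← tens_eq]
  simp only [comb, add_lie, lie_add, lie_tens, lie_self, lie_eqX_eqY, lie_eqY_eqZ, lie_eqZ_eqX,
    h1, h2, h3, tens_neg, tens_add, tens_smul, tens_zero, h5]
  rw [tens_eq F (eqX F) (2 * (a * b' - b * a') + 2 * (c * a' - a * c')),
    tens_eq F (eqY F) (2 * (a * b' - b * a') + 2 * (b * c' - c * b')),
    tens_eq F (eqZ F) (2 * (b * c' - c * b') + 2 * (c * a' - a * c'))]
  module

theorem comb_add (a b c a' b' c' : LoopRing F) :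
    comb F a b c + comb F a' b' c' = comb F (a + a') (b + b') (c + c') := by
  simp only [comb]
  rw [tens_eq F _ a, tens_eq F _ b, tens_eq F _ c, tens_eq F _ a', tens_eq F _ b', tens_eq F _ c',
    tens_eq F _ (a + a'), tens_eq F _ (b + b'), tens_eq F _ (c + c')]
  module

theorem comb_smul (r a b c : LoopRing F) : r • comb F a b c = comb F (r * a) (r * b) (r * c) := by
  simp only [comb, smul_add, smul_tens]

theorem comb_neg (a b c : LoopRing F) : -comb F a b c = comb F (-a) (-b) (-c) := by
  have := comb_smul F (-1) a b c
  simpa using this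

theorem comb_two (a b c : LoopRing F) :
    (2 : F) • comb F a b c = comb F (2 * a) (2 * b) (2 * c) := by
  rw [two_smul, comb_add, two_mul, two_mul, two_mul]

theorem comb_four (a b c : LoopRing F) :
    (4 : F) • comb F a b c = comb F (4 * a) (4 * b) (4 * c) := by
  rw [show (4 : F) = 2 * 2 by norm_num, mul_smul, comb_two, comb_two]
  simp only [← mul_assoc]
  norm_num

theorem comb_congr {a b c a' b' c' : LoopRing F} (ha : a = a') (hb : b = b') (hc : c = c') :
    comb F a b c = comb F a' b' c' := by
  rw [ha, hb, hc]

theorem tens_eqX (a : LoopRing F) : tens (eqX F) a = comb F a 0 0 := by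
  simp [comb, tens_eq F _ (0 : LoopRing F)]

theorem tens_eqY (a : LoopRing F) : tens (eqY F) a = comb F 0 a 0 := by
  simp [comb, tens_eq F _ (0 : LoopRing F)]

theorem tens_eqZ (a : LoopRing F) : tens (eqZ F) a = comb F 0 0 a := by
  simp [comb, tens_eq F _ (0 : LoopRing F)]

theorem t_mul_tPrime : (t F : LoopRing F) * tPrime F = t F - 1 := by
  rw [tPrime, mul_sub, Units.mul_inv, mul_one]

theorem one_sub_t_mul_tDouble : (1 - (t F : LoopRing F)) * tDouble F = 1 :=
  IsUnit.mul_val_inv (isUnit_one_sub_t F)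

theorem loopGen_skew (i j : Fin 4) : loopGen F i j + loopGen F j i = 0 := by
  fin_cases i <;> fin_cases j <;> simp [loopGen]

set_option maxHeartbeats 1000000 in
theorem loopGen_triple_aux (i j k : Fin 4) (hij : i ≠ j) (hjk : j ≠ k) (hik : i < k) :
    ⁅loopGen F i j, loopGen F j k⁆ = (2 : F) • loopGen F i j + (2 : F) • loopGen F j k := by
  have h1 : (t F : LoopRing F) * ↑(t F)⁻¹ = 1 := Units.mul_inv _
  have h2 := one_sub_t_mul_tDouble F
  have h3 : (i, j, k) ∈ ({(0, 2, 1), (0, 3, 1), (0, 1, 2), (0, 3, 2), (0, 1, 3), (0, 2, 3),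
      (1, 0, 2), (1, 3, 2), (1, 0, 3), (1, 2, 3), (2, 0, 3), (2, 1, 3)} :
        Finset (Fin 4 × Fin 4 × Fin 4)) := by
    revert i j k; decide
  simp only [Finset.mem_insert, Finset.mem_singleton, Prod.mk.injEq] at h3
  clear hij hjk hik
  generalize hc : tDouble F = c at h2
  generalize hb : (↑(t F)⁻¹ : LoopRing F) = b at h1
  generalize ha : (t F : LoopRing F) = a at h1 h2
  rcases h3 with h | h | h | h | h | h | h | h | h | h | h | h <;> obtain ⟨rfl, rfl, rfl⟩ := h
  all_goals
    simp only [loopGen, tens_eqX, tens_eqY, tens_eqZ, comb_add, comb_neg, comb_two, lie_comb,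
      tPrime, ha, hb, hc]
    clear ha hb hc
    apply comb_congr <;> grind

theorem loopGen_triple (i j k : Fin 4) (hij : i ≠ j) (hjk : j ≠ k) (hik : i ≠ k) :
    ⁅loopGen F i j, loopGen F j k⁆ = (2 : F) • loopGen F i j + (2 : F) • loopGen F j k := by
  rcases lt_or_gt_of_ne hik with h | h
  · exact loopGen_triple_aux F i j k hij hjk h
  · have h1 := loopGen_triple_aux F k j i hjk.symm hij.symm h
    rw [eq_neg_of_add_eq_zero_left (loopGen_skew F i j),
      eq_neg_of_add_eq_zero_left (loopGen_skew F j k), neg_lie, lie_neg, neg_neg, ← lie_skew, h1]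
    module

theorem lie_lie_lie_comb (a b c a' b' c' : LoopRing F)
    (hN : a ^ 2 + b ^ 2 + c ^ 2 - 2 * (a * b + b * c + c * a) = 1) :
    ⁅comb F a b c, ⁅comb F a b c, ⁅comb F a b c, comb F a' b' c'⁆⁆⁆
      = (4 : F) • ⁅comb F a b c, comb F a' b' c'⁆ := by
  simp only [lie_comb, comb_four]
  apply comb_congr
  · linear_combination 4 * (2 * (a * b' - b * a') + 2 * (c * a' - a * c')) * hN
  · linear_combination 4 * (2 * (a * b' - b * a') + 2 * (b * c' - c * b')) * hN
  · linear_combination 4 * (2 * (b * c' - c * b') + 2 * (c * a' - a * c')) * hN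

theorem loopGen_eq_comb (i j : Fin 4) (hij : i ≠ j) : ∃ a b c, loopGen F i j = comb F a b c ∧
    a ^ 2 + b ^ 2 + c ^ 2 - 2 * (a * b + b * c + c * a) = 1 := by
  fin_cases i <;> fin_cases j <;> first | exact absurd rfl hij | skip
  all_goals
    simp only [loopGen, Fin.zero_eta, Fin.mk_one, Fin.reduceFinMk, tens_eqX, tens_eqY, tens_eqZ,
      comb_add, comb_neg]
    refine ⟨_, _, _, rfl, ?_⟩
    ring

theorem loopGen_dolanGrady (h i j k : Fin 4) (hij : i ≠ j) (hkh : k ≠ h) :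
    ⁅loopGen F i j, ⁅loopGen F i j, ⁅loopGen F i j, loopGen F k h⁆⁆⁆
      = (4 : F) • ⁅loopGen F i j, loopGen F k h⁆ := by
  obtain ⟨a, b, c, h1, h2⟩ := loopGen_eq_comb F i j hij
  obtain ⟨a', b', c', h3, -⟩ := loopGen_eq_comb F k h hkh
  rw [h1, h3]
  exact lie_lie_lie_comb F a b c a' b' c' h2

/-- The homomorphism `σ` from the tetrahedron algebra to the loop algebra. -/
def sigma : Tet F →ₗ⁅F⁆ Loop F :=
  PresentedLie.lift _ (fun p : TetIndex => loopGen F p.1.1 p.1.2) (by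
    rintro r (⟨i, j, hij⟩ | ⟨i, j, k, hij, hjk, hik⟩ | ⟨h, i, j, k, hhi, hhj, hij, hik, hjk, hkh⟩)
    · simp only [freeX, map_add, FreeLieAlgebra.lift_of_apply]
      exact loopGen_skew F i j
    · simp only [freeX, map_sub, map_add, map_smul, LieHom.map_lie, FreeLieAlgebra.lift_of_apply]
      exact sub_eq_zero.2 (loopGen_triple F i j k hij hjk hik)
    · simp only [freeX, map_sub, map_smul, LieHom.map_lie, FreeLieAlgebra.lift_of_apply]
      exact sub_eq_zero.2 (loopGen_dolanGrady F h i j k hij hkh))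

theorem sigma_x (i j : Fin 4) (hij : i ≠ j) : sigma F (x F i j hij) = loopGen F i j :=
  PresentedLie.lift_gen _ _ _ _

/-- The homomorphism from `O` to the loop algebra through which `O` is identified with the subalgebra
generated by `A = x ⊗ 1` and `B = y ⊗ t + z ⊗ (t - 1)`. -/
def toLoop : O F →ₗ⁅F⁆ Loop F := (sigma F).comp (toTet F)

theorem toLoop_genA : toLoop F (genA F) = tens (eqX F) 1 := by
  rw [toLoop, LieHom.comp_apply, toTet_genA, sigma_x]; rfl

theorem toLoop_genB :
    toLoop F (genB F) = tens (eqY F) (t F) + tens (eqZ F) (t F - 1) := by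
  rw [toLoop, LieHom.comp_apply, toTet_genB, sigma_x]; rfl

/-! ### The elements of the basis `[3012]` -/

/-- `A_i = x ⊗ (-t)^i`. -/
def elemA (i : ℕ) : Loop F := tens (eqX F) ((-(t F : LoopRing F)) ^ i)

/-- `B_i = (-(y ⊗ t) - z ⊗ (t - 1)) (-t)^i`. -/
def elemB (i : ℕ) : Loop F :=
  (-(t F : LoopRing F)) ^ i • (-tens (eqY F) (t F) - tens (eqZ F) (t F - 1))

/-- `ψ_i = (x ⊗ 1 - z ⊗ (t - 1)) (-t)^(i - 1)`; the exponent is an integer, equal to `-1` when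
`i = 0`. -/
def elemPsi (i : ℕ) : Loop F :=
  (((-(t F)) ^ ((i : ℤ) - 1) : (LoopRing F)ˣ) : LoopRing F) •
    (tens (eqX F) 1 - tens (eqZ F) (t F - 1))

end Onsager

end

/-! The six bracket formulas are direct computations in the coordinates of `comb`. The substance
lies in showing that `O` is no larger than the span of the proposed basis, and in the claims about
the tetrahedron algebra.

Solving the bracket formulas for the next vectors in terms of earlier ones gives a recursion that
makes sense inside `O`; its solution `seq` maps to the family `elem` (`toLoop_seq`). As x, y, z are
independent over the loop ring and t is transcendental over F, `elem` is linearly independent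
(`linearIndependent_elem`), hence so is `seq`.

Spanning uses Onsager's classical description of `O`. The Dolan–Grady relations are preserved by an
invertible translation (`dolanGrady_step`, `exists_onsager_family`), whose orbit A m of the
generators obeys [A (m + n), A m] = 2 G n and [G n, A m] = A (m + n) - A (m - n)
(`onsager_brackets`). So `O` is exhausted by subspaces of dimension at most 3(n + 1), each
containing 3(n + 1) independent vectors of `seq`. Thus `seq` is a basis (`span_seq`). A linear map
taking a basis to an independent family is injective, which gives `toLoop_injective`.

Injectivity lets identities in `O` be checked in the loop algebra, which settles likeness for the
first two families. The third involves x_01 and x_23, and injectivity is established only for `O`,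
not for `sigma`. There, the action of x_01 and x_23 is carried along the recursion inside the
tetrahedron algebra, by Leibniz (`lie_psi_eq_zero`, `lie_lie_lie_psi`). -/

noncomputable section

namespace Onsager

/-! ### Generation of Lie algebras given by generators and relations -/

section Presentation

variable {F : Type*} [Field F] {X : Type*} {rels : Set (FreeLieAlgebra F X)}
  {L : Type*} [LieRing L] [LieAlgebra F L]

/-- Homomorphisms out of a presented Lie algebra are determined by the generators. -/
theorem PresentedLie.hom_ext {φ ψ : PresentedLie F rels →ₗ⁅F⁆ L}
    (h : ∀ a, φ (PresentedLie.gen rels a) = ψ (PresentedLie.gen rels a)) : φ = ψ := by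
  have key : φ.comp (PresentedLie.mk rels) = ψ.comp (PresentedLie.mk rels) :=
    FreeLieAlgebra.hom_ext h
  ext u
  obtain ⟨u, rfl⟩ := PresentedLie.mk_surjective rels u
  exact LieHom.congr_fun key u

/-- The generators generate a presented Lie algebra. -/
theorem PresentedLie.eq_top_of_gen_mem (K : LieSubalgebra F (PresentedLie F rels))
    (h : ∀ a, PresentedLie.gen rels a ∈ K) : K = ⊤ := by
  have hr : ∀ r ∈ rels, FreeLieAlgebra.lift F
      (fun a => (⟨PresentedLie.gen rels a, h a⟩ : K)) r = 0 := by
    intro r hr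
    have key : K.incl.comp (FreeLieAlgebra.lift F
        (fun a => (⟨PresentedLie.gen rels a, h a⟩ : K))) = PresentedLie.mk rels := by
      apply FreeLieAlgebra.hom_ext
      intro a
      rw [LieHom.comp_apply, FreeLieAlgebra.lift_of_apply]
      rfl
    apply Subtype.ext
    have := LieHom.congr_fun key r
    rw [PresentedLie.mk_eq_zero hr] at this
    exact this
  have key : K.incl.comp (PresentedLie.lift rels
      (fun a => (⟨PresentedLie.gen rels a, h a⟩ : K)) hr) = LieHom.id := by
    apply PresentedLie.hom_ext
    intro a
    rw [LieHom.comp_apply, PresentedLie.lift_gen]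
    rfl
  rw [eq_top_iff]
  intro u _
  have := LieHom.congr_fun key u
  rw [LieHom.id_apply] at this
  rw [← this]
  exact SetLike.coe_mem _

/-- A subspace that contains the generators and is stable under their adjoint actions is the whole
presented Lie algebra. -/
theorem PresentedLie.eq_top_of_lie_gen_mem (S : Submodule F (PresentedLie F rels))
    (h : ∀ a, PresentedLie.gen rels a ∈ S)
    (hS : ∀ a, ∀ u ∈ S, ⁅PresentedLie.gen rels a, u⁆ ∈ S) : S = ⊤ := by
  -- The elements whose adjoint action preserves S form a subalgebra by Jacobi. It contains the
  -- generators, so S is an ideal, in particular a subalgebra.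
  let N : LieSubalgebra F (PresentedLie F rels) :=
    { carrier := {v | ∀ u ∈ S, ⁅v, u⁆ ∈ S}
      add_mem' := fun {v w} hv hw u hu => by rw [add_lie]; exact S.add_mem (hv u hu) (hw u hu)
      zero_mem' := fun u _ => by rw [zero_lie]; exact S.zero_mem
      smul_mem' := fun c v hv u hu => by rw [smul_lie]; exact S.smul_mem c (hv u hu)
      lie_mem' := fun {v w} hv hw u hu => by
        rw [lie_lie]; exact S.sub_mem (hv _ (hw u hu)) (hw _ (hv u hu)) }
  have hN : N = ⊤ := PresentedLie.eq_top_of_gen_mem N hS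
  let K : LieSubalgebra F (PresentedLie F rels) :=
    { S with
      lie_mem' := fun {v w} _ hw =>
        (show v ∈ N by rw [hN]; exact LieSubalgebra.mem_top v) w hw }
  have hK : K = ⊤ := PresentedLie.eq_top_of_gen_mem K h
  rw [eq_top_iff]
  intro u _
  have : u ∈ K := by rw [hK]; exact LieSubalgebra.mem_top u
  exact this

end Presentation

/-! ### Translation of Dolan–Grady pairs -/

section DolanGradyPairs

variable {F : Type*} [Field F] [CharZero F] {L : Type*} [LieRing L] [LieAlgebra F L]

/-- From a Dolan–Grady pair `a₀, a₁` one obtains the Dolan–Grady pair `a₁, a₂`, where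
`a₂ = a₀ + [k, a₁]` and `2 k = [a₁, a₀]`. -/
theorem dolanGrady_step {a0 a1 k : L} (hk : ⁅a1, a0⁆ = (2 : F) • k)
    (h0 : ⁅a0, ⁅a0, ⁅a0, a1⁆⁆⁆ = (4 : F) • ⁅a0, a1⁆)
    (h1 : ⁅a1, ⁅a1, ⁅a1, a0⁆⁆⁆ = (4 : F) • ⁅a1, a0⁆) :
    ⁅a0 + ⁅k, a1⁆, a1⁆ = (2 : F) • k ∧
    ⁅a1, ⁅a1, ⁅a1, a0 + ⁅k, a1⁆⁆⁆⁆ = (4 : F) • ⁅a1, a0 + ⁅k, a1⁆⁆ ∧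
    ⁅a0 + ⁅k, a1⁆, ⁅a0 + ⁅k, a1⁆, ⁅a0 + ⁅k, a1⁆, a1⁆⁆⁆ = (4 : F) • ⁅a0 + ⁅k, a1⁆, a1⁆ := by
  -- Extend the pair to a sequence b2, b1, a0, a1, a2, a3, a4, with b1 and b2 at indices -1 and -2,
  -- so that ad k sends each inner term to its successor minus its predecessor.
  obtain ⟨a2, h2⟩ : ∃ a2, a2 = a0 + ⁅k, a1⁆ := ⟨_, rfl⟩
  obtain ⟨a3, h3⟩ : ∃ a3, a3 = a1 + ⁅k, a2⁆ := ⟨_, rfl⟩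
  obtain ⟨a4, h4⟩ : ∃ a4, a4 = a2 + ⁅k, a3⁆ := ⟨_, rfl⟩
  obtain ⟨b1, hb1⟩ : ∃ b1, b1 = a1 - ⁅k, a0⁆ := ⟨_, rfl⟩
  obtain ⟨b2, hb2⟩ : ∃ b2, b2 = a0 - ⁅k, b1⁆ := ⟨_, rfl⟩
  rw [← h2]
  have k1 : ⁅k, a1⁆ = a2 - a0 := by rw [h2]; abel
  have k2 : ⁅k, a2⁆ = a3 - a1 := by rw [h3]; abel
  have k3 : ⁅k, a3⁆ = a4 - a2 := by rw [h4]; abel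
  have k0 : ⁅k, a0⁆ = a1 - b1 := by rw [hb1]; abel
  have kb1 : ⁅k, b1⁆ = a0 - b2 := by rw [hb2]; abel
  clear h2 h3 h4 hb1 hb2
  have s10 : ⁅a0, a1⁆ = -((2 : F) • k) := by rw [← hk, lie_skew]
  have k1' : ⁅a1, k⁆ = a0 - a2 := by rw [← lie_skew, k1]; abel
  have k2' : ⁅a2, k⁆ = a1 - a3 := by rw [← lie_skew, k2]; abel
  have k0' : ⁅a0, k⁆ = b1 - a1 := by rw [← lie_skew, k0]; abel
  -- In this notation each Dolan–Grady relation says that one more pair of neighbours has bracket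
  -- 2k: `h1` gives it for a2, a1 and `h0` for a0, b1.
  have e12 : ⁅a1, a2⁆ = -((2 : F) • k) := by
    rw [hk, lie_smul, lie_smul, k1', lie_sub, hk] at h1
    linear_combination (norm := module) (-1/2 : F) • h1
  have e21 : ⁅a2, a1⁆ = (2 : F) • k := by rw [← lie_skew, e12, neg_neg]
  have e01 : ⁅a0, b1⁆ = (2 : F) • k := by
    rw [s10, lie_neg, lie_neg, lie_smul, lie_smul, k0', lie_sub, s10] at h0
    linear_combination (norm := module) (-1/2 : F) • h0
  obtain ⟨g, hg⟩ : ∃ g, ⁅a2, a0⁆ = (2 : F) • g :=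
    ⟨(1/2 : F) • ⁅a2, a0⁆, by rw [smul_smul]; norm_num⟩
  have J1 := leibniz_lie k a2 a1
  have J2 := leibniz_lie k a1 a0
  simp only [hk, e21, k0, k1, k2, lie_smul, lie_self, lie_sub, sub_lie, smul_zero]
    at J1 J2
  have g31 : ⁅a3, a1⁆ = (2 : F) • g := by
    linear_combination (norm := module) -J1 + hg
  have g1b : ⁅a1, b1⁆ = (2 : F) • g := by
    linear_combination (norm := module) J2 + hg
  have J3 := leibniz_lie a1 a2 a0
  simp only [hg, e12, hk, lie_smul, neg_lie, smul_lie, k0, k2'] at J3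
  have J4 := leibniz_lie a0 a1 b1
  simp only [g1b, s10, e01, lie_smul, neg_lie, smul_lie, kb1, k1'] at J4
  have ga1 : ⁅g, a1⁆ = a3 - b1 := by
    rw [← lie_skew]
    linear_combination (norm := module) (-1/2 : F) • J3
  have ga0 : ⁅g, a0⁆ = a2 - b2 := by
    rw [← lie_skew]
    linear_combination (norm := module) (-1/2 : F) • J4
  have J5 := leibniz_lie k a2 a0
  have J6 := leibniz_lie k a1 b1
  have J7 := leibniz_lie g a1 a0
  have sb : ⁅b1, a0⁆ = -((2 : F) • k) := by rw [← e01, lie_skew]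
  have gk : ⁅g, k⁆ = -⁅k, g⁆ := by rw [lie_skew]
  simp only [hg, g1b, hk, lie_smul, sub_lie, lie_sub, k0, k1, k2, kb1, ga1, ga0, e12, e21, e01, sb,
    gk] at J5 J6 J7
  -- Consider [a3, a0], [a2, b1], [a1, b2], all of index difference 3. By `J5` and `J6` each exceeds
  -- the next by 2[k, g], while by `J7` the first exceeds the last by -2[k, g]. Hence 6[k, g] = 0.
  have kg : ⁅k, g⁆ = 0 := by
    have : (6 : F) • ⁅k, g⁆ = 0 := by
      linear_combination (norm := module) J5 + J6 - J7
    exact (smul_eq_zero.1 this).resolve_left (by norm_num)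
  have J8 := leibniz_lie k a3 a1
  have J9 := leibniz_lie g k a1
  simp only [gk, kg, k1, ga1, g31, lie_smul, sub_lie, lie_sub, k3, kb1, ga0, e21,
    neg_zero, zero_lie, smul_zero] at J5 J6 J7 J8 J9
  have ga2 : ⁅g, a2⁆ = a4 - a0 := by linear_combination (norm := module) J9
  have J10 := leibniz_lie g a2 a1
  simp only [e21, ga2, ga1, lie_smul, gk, kg, sub_lie, lie_sub, neg_zero, smul_zero, s10] at J10
  -- The brackets of index difference 3 cancel between `J8`, `J10` and `J5`. What remains is the
  -- neighbour relation for a3, a2, equivalent to the missing Dolan–Grady relation for a2, a1.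
  have e32 : ⁅a2, a3⁆ = -((2 : F) • k) := by
    have s : ⁅a3, a2⁆ = -⁅a2, a3⁆ := by rw [lie_skew]
    rw [s] at J8
    linear_combination (norm := module) (1/2 : F) • (J8 - J10 + J5)
  refine ⟨e21, ?_, ?_⟩
  · simp only [e12, lie_neg, lie_smul, k1', lie_sub, hk]
    module
  · simp only [e21, lie_smul, k2', lie_sub, e32]
    module

end DolanGradyPairs

/-! ### Onsager's commutation relations -/

section OnsagerBrackets

variable {F : Type*} [Field F] [CharZero F] {L : Type*} [LieRing L] [LieAlgebra F L]

/-- The bracket relations of the Onsager basis `A m`, `G n`. -/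
theorem onsager_brackets {A : ℤ → L} {k : L}
    (hk : ∀ m, ⁅A (m + 1), A m⁆ = (2 : F) • k)
    (hkA : ∀ m, ⁅k, A m⁆ = A (m + 1) - A (m - 1)) {G : ℕ → L}
    (hG : ∀ n : ℕ, ⁅A n, A 0⁆ = (2 : F) • G n) (n : ℕ) :
    (∀ m, ⁅A (m + n), A m⁆ = (2 : F) • G n) ∧
      ∀ m, ⁅G n, A m⁆ = A (m + n) - A (m - n) := by
  have two : (2 : F) ≠ 0 := two_ne_zero
  have hG0 : G 0 = 0 := by
    have := hG 0
    simp only [Nat.cast_zero, lie_self] at this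
    exact (smul_eq_zero.1 this.symm).resolve_left two
  have hG1 : G 1 = k := by
    have h1 := hG 1
    have h2 := hk 0
    simp only [Nat.cast_one, zero_add] at h1 h2
    exact smul_right_injective L two (h1.symm.trans h2)
  induction n using Nat.twoStepInduction with
  | zero => simp [hG0]
  | one => simpa [hG1] using ⟨hk, hkA⟩
  | more n ih0 ih1 =>
    obtain ⟨p0, q0⟩ := ih0
    obtain ⟨p1, q1⟩ := ih1
    push_cast at p1 q1 ⊢
    -- Applying ad k to [A (m + n + 1), A m] = 2 G (n + 1) shows that brackets of index difference n
    -- + 2 depend on m only through an arithmetic progression with step 2[k, G (n + 1)].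
    have step : ∀ m : ℤ, ⁅A (m + (n + 2)), A m⁆ =
        ⁅A ((m - 1) + (n + 2)), A (m - 1)⁆ + (2 : F) • ⁅k, G (n + 1)⁆ := by
      intro m
      have J := leibniz_lie k (A (m + (n + 1))) (A m)
      have e := p0 m
      have e' := p0 (m + 1)
      rw [p1, hkA, hkA, lie_smul, sub_lie, lie_sub] at J
      rw [show m + (n + 1 : ℤ) + 1 = m + (n + 2) by ring,
        show m + (n + 1 : ℤ) - 1 = m + n by ring, e,
        show m + (n + 1 : ℤ) = m + 1 + n by ring, e',
        show m + 1 + (n : ℤ) = m - 1 + (n + 2) by ring] at J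
      linear_combination (norm := module) -J
    have prog : ∀ j : ℕ, ⁅A (-(j : ℤ) + (n + 2)), A (-(j : ℤ))⁆ =
        (2 : F) • G (n + 2) - (2 * j : F) • ⁅k, G (n + 1)⁆ := by
      intro j
      induction j with
      | zero =>
        have := hG (n + 2)
        push_cast at this
        simp [this]
      | succ j ih =>
        have := step (-(j : ℤ))
        rw [ih, show -(j : ℤ) - 1 = -((j + 1 : ℕ) : ℤ) by push_cast; ring] at this
        push_cast at this ⊢
        linear_combination (norm := module) -this
    -- Applying ad G (n + 1) to [A 1, A 0] = 2k produces the progression at m = 0 and m = -(n + 1).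
    -- Comparison leaves 2(n + 2)[k, G (n + 1)] = 0, so characteristic zero makes the progression
    -- constant.
    have comm : ⁅k, G (n + 1)⁆ = 0 := by
      have J := leibniz_lie (G (n + 1)) (A 1) (A 0)
      have e := hk 0
      rw [zero_add] at e
      have e1 := hG (n + 2)
      have e2 := p0 (-n)
      have e3 := prog (n + 1)
      have e4 := p0 1
      have s := lie_skew (A (-(n : ℤ))) (A 0)
      have s' := lie_skew (A 1) (A (1 + n))
      have s3 := lie_skew k (G (n + 1))
      push_cast at e1 e3
      rw [neg_add_cancel] at e2
      rw [show -((n : ℤ) + 1) + (n + 2) = 1 by ring] at e3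
      rw [e, q1, q1, lie_smul, sub_lie, lie_sub, show (1 : ℤ) + (n + 1) = n + 2 by ring,
        show (1 : ℤ) - (n + 1) = -n by ring, show (0 : ℤ) + (n + 1) = 1 + n by ring,
        show (0 : ℤ) - (n + 1) = -(n + 1) by ring] at J
      have : (2 * (n + 2) : F) • ⁅k, G (n + 1)⁆ = 0 := by
        linear_combination (norm := module) -J - (2 : F) • s3 - e1 - s - e2 + s' + e4 + e3
      refine (smul_eq_zero.1 this).resolve_left (mul_ne_zero two ?_)
      exact_mod_cast (Nat.succ_ne_zero (n + 1))
    have p2 : ∀ m : ℤ, ⁅A (m + (n + 2)), A m⁆ = (2 : F) • G (n + 2) := by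
      have e := hG (n + 2)
      push_cast at e
      intro m
      induction m with
      | zero => rw [zero_add, e]
      | succ i ih =>
        have := step (i + 1)
        rwa [add_sub_cancel_right, ih, comm, smul_zero, add_zero] at this
      | pred i ih =>
        have := step (-i)
        rw [ih, comm, smul_zero, add_zero] at this
        exact this.symm
    refine ⟨p2, fun m => ?_⟩
    -- The pair is chosen so that its bracket is 2 G (n + 2), while A m has index differences only n
    -- + 1 and 1 with its members, both already known.
    have J := leibniz_lie (A m) (A (m - 1 + (n + 2))) (A (m - 1))
    have e := hk (m - 1)
    have e1 := p1 m
    have e2 := q1 (m - 1)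
    have e3 := hkA (m + (n + 1))
    have s2 := lie_skew (A (m + (n + 1))) k
    have s3 := lie_skew (A m) (G (n + 2))
    have e4 : ⁅A m, A (m + (n + 1))⁆ = -((2 : F) • G (n + 1)) := by rw [← e1, lie_skew]
    rw [sub_add_cancel] at e
    rw [p2, e, show m - 1 + ((n : ℤ) + 2) = m + (n + 1) by ring, lie_smul, lie_smul, e4, neg_lie,
      smul_lie, e2, ← s2, e3, show m - 1 + (n + 1 : ℤ) = m + n by ring,
      show m - 1 - (n + 1 : ℤ) = m - (n + 2) by ring,
      show m + (n + 1 : ℤ) + 1 = m + (n + 2) by ring,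
      show m + (n + 1 : ℤ) - 1 = m + n by ring] at J
    linear_combination (norm := module) (-1/2 : F) • J - s3

end OnsagerBrackets

/-! ### The translation automorphism of the Onsager algebra -/

section OnsagerAlgebra

variable (F : Type*) [Field F]

theorem genA_dolanGrady :
    ⁅genA F, ⁅genA F, ⁅genA F, genB F⁆⁆⁆ = (4 : F) • ⁅genA F, genB F⁆ :=
  sub_eq_zero.1 (by
    have := PresentedLie.mk_eq_zero (show _ ∈ {r | DolanGrady F r} from DolanGrady.rel_A)
    simp only [map_sub, map_smul, LieHom.map_lie] at this
    exact this)

theorem genB_dolanGrady :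
    ⁅genB F, ⁅genB F, ⁅genB F, genA F⁆⁆⁆ = (4 : F) • ⁅genB F, genA F⁆ :=
  sub_eq_zero.1 (by
    have := PresentedLie.mk_eq_zero (show _ ∈ {r | DolanGrady F r} from DolanGrady.rel_B)
    simp only [map_sub, map_smul, LieHom.map_lie] at this
    exact this)

variable {F} {L : Type*} [LieRing L] [LieAlgebra F L]

/-- A Dolan–Grady pair is the image of the standard generators. -/
theorem exists_hom_of_dolanGrady {a b : L} (ha : ⁅a, ⁅a, ⁅a, b⁆⁆⁆ = (4 : F) • ⁅a, b⁆)
    (hb : ⁅b, ⁅b, ⁅b, a⁆⁆⁆ = (4 : F) • ⁅b, a⁆) :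
    ∃ φ : O F →ₗ⁅F⁆ L, φ (genA F) = a ∧ φ (genB F) = b := by
  refine ⟨PresentedLie.lift _ ![a, b] ?_, PresentedLie.lift_gen _ _ _ _,
    PresentedLie.lift_gen _ _ _ _⟩
  rintro r (_ | _)
  · simpa [FreeLieAlgebra.lift_of_apply, sub_eq_zero] using ha
  · simpa [FreeLieAlgebra.lift_of_apply, sub_eq_zero] using hb

theorem O.hom_ext {φ ψ : O F →ₗ⁅F⁆ L} (hA : φ (genA F) = ψ (genA F))
    (hB : φ (genB F) = ψ (genB F)) : φ = ψ :=
  PresentedLie.hom_ext (Fin.forall_fin_two.2 ⟨hA, hB⟩)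

variable (F) [CharZero F]

/-- The elements `A m` of the Onsager basis: the orbit of the generators under the translation
automorphism `A 0 ↦ A 1`, `A 1 ↦ A 2`. -/
theorem exists_onsager_family : ∃ (A : ℤ → O F) (k : O F), A 0 = genA F ∧ A 1 = genB F ∧
    (∀ m, ⁅A (m + 1), A m⁆ = (2 : F) • k) ∧ ∀ m, ⁅k, A m⁆ = A (m + 1) - A (m - 1) := by
  obtain ⟨k, hk⟩ : ∃ k, ⁅genB F, genA F⁆ = (2 : F) • k :=
    ⟨(1/2 : F) • ⁅genB F, genA F⁆, by rw [smul_smul]; norm_num⟩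
  have hk' : ⁅genA F, genB F⁆ = (2 : F) • (-k) := by rw [← lie_skew, hk, smul_neg]
  have half : ∀ {u v : O F}, (2 : F) • u = (2 : F) • v → u = v := fun h =>
    smul_right_injective _ (two_ne_zero (α := F)) h
  obtain ⟨e1, d1, d2⟩ := dolanGrady_step hk (genA_dolanGrady F) (genB_dolanGrady F)
  -- The same step for the reversed pair, with -k in place of k, supplies the inverse translation.
  obtain ⟨e1', d1', d2'⟩ := dolanGrady_step hk' (genB_dolanGrady F) (genA_dolanGrady F)
  obtain ⟨τ, τA, τB⟩ := exists_hom_of_dolanGrady d1 d2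
  obtain ⟨ρ, ρB, ρA⟩ := exists_hom_of_dolanGrady d2' d1'
  have τk : τ k = k := half (by rw [← map_smul, ← hk, LieHom.map_lie, τA, τB, e1, hk])
  have ρk : ρ k = k := half (by
    rw [← map_smul, ← hk, LieHom.map_lie, ρA, ρB, ← lie_skew, e1', hk, smul_neg, neg_neg])
  have τρ : τ.comp ρ = LieHom.id := by
    apply O.hom_ext
    · simp only [LieHom.comp_apply, LieHom.id_apply, ρB, map_add, LieHom.map_lie, map_neg, τA, τB,
        τk, neg_lie]
      abel
    · simp [ρA, τA]
  have ρτ : ρ.comp τ = LieHom.id := by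
    apply O.hom_ext
    · simp [ρA, τA]
    · simp only [LieHom.comp_apply, LieHom.id_apply, τB, map_add, LieHom.map_lie, ρA, ρB, ρk,
        neg_lie]
      abel
  let A : ℤ → O F := fun m => match m with
    | .ofNat n => τ^[n] (genA F)
    | .negSucc n => ρ^[n + 1] (genA F)
  have hτ : ∀ m, τ (A m) = A (m + 1) := by
    rintro (n | n)
    · exact (Function.iterate_succ_apply' τ n _).symm
    · rcases n with _ | n
      · exact LieHom.congr_fun τρ (genA F)
      · change τ (ρ^[n + 2] (genA F)) = ρ^[n + 1] (genA F)
        rw [Function.iterate_succ_apply' ρ]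
        exact LieHom.congr_fun τρ _
  have hρ : ∀ m, ρ (A (m + 1)) = A m := fun m => by
    rw [← hτ]; exact LieHom.congr_fun ρτ _
  have hρ' : ∀ m, ρ (A m) = A (m - 1) := fun m => by
    rw [← hρ (m - 1), sub_add_cancel]
  have A1 : A 1 = genB F := τA
  have A0 : A 0 = genA F := rfl
  have Am1 : A (-1) = genB F + ⁅-k, genA F⁆ := ρB
  refine ⟨A, k, A0, A1, fun m => ?_, fun m => ?_⟩
  · induction m with
    | zero => rw [zero_add, A1, A0, hk]
    | succ i ih =>
      have := congrArg τ ih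
      rwa [LieHom.map_lie, map_smul, τk, hτ (i : ℤ), hτ] at this
    | pred i ih =>
      have := congrArg ρ ih
      rwa [LieHom.map_lie, map_smul, ρk, hρ', hρ', add_sub_right_comm] at this
  · induction m with
    | zero => rw [zero_add, zero_sub, A1, A0, Am1, neg_lie]; abel
    | succ i ih =>
      have := congrArg τ ih
      rwa [LieHom.map_lie, map_sub, τk, hτ (i : ℤ), hτ, hτ, ← add_sub_right_comm] at this
    | pred i ih =>
      have := congrArg ρ ih
      rwa [LieHom.map_lie, map_sub, ρk, hρ', hρ', hρ', add_sub_right_comm] at this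

end OnsagerAlgebra

/-! ### An exhaustion of the Onsager algebra with dimension bounds -/

section Filtration

variable {F : Type*} [Field F] {L : Type*} [LieRing L] [LieAlgebra F L]

/-- The span of `A m` for `-n ≤ m ≤ n + 1` and of `G 1, …, G l`. -/
def onsagerSpan (F : Type*) [Field F] {L : Type*} [LieRing L] [LieAlgebra F L]
    (A : ℤ → L) (G : ℕ → L) (n l : ℕ) : Submodule F L :=
  Submodule.span F (A '' Set.Icc (-(n : ℤ)) (n + 1) ∪ (fun i => G (i + 1)) '' Set.Iio l)

variable {A : ℤ → L} {G : ℕ → L}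

theorem mem_onsagerSpan_A {n l : ℕ} {m : ℤ} (h1 : -(n : ℤ) ≤ m) (h2 : m ≤ n + 1) :
    A m ∈ onsagerSpan F A G n l :=
  Submodule.subset_span (Or.inl ⟨m, ⟨h1, h2⟩, rfl⟩)

theorem mem_onsagerSpan_G {n l i : ℕ} (h : i < l) : G (i + 1) ∈ onsagerSpan F A G n l :=
  Submodule.subset_span (Or.inr ⟨i, h, rfl⟩)

theorem onsagerSpan_mono {n l n' l' : ℕ} (hn : n ≤ n') (hl : l ≤ l') :
    onsagerSpan F A G n l ≤ onsagerSpan F A G n' l' := by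
  refine Submodule.span_mono (Set.union_subset_union (Set.image_mono ?_) (Set.image_mono ?_))
  · exact Set.Icc_subset_Icc (by omega) (by omega)
  · exact Set.Iio_subset_Iio hl

theorem finrank_onsagerSpan_le (n l : ℕ) :
    Module.finrank F (onsagerSpan F A G n l) ≤ 2 * n + 2 + l := by
  classical
  have h : (A '' Set.Icc (-(n : ℤ)) (n + 1) ∪ (fun i => G (i + 1)) '' Set.Iio l) =
      ((Finset.Icc (-(n : ℤ)) (n + 1)).image A ∪ (Finset.Iio l).image (fun i => G (i + 1)) :
        Finset L) := by simp
  rw [onsagerSpan, h]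
  refine (finrank_span_finset_le_card _).trans ((Finset.card_union_le _ _).trans ?_)
  refine add_le_add (Finset.card_image_le.trans ?_) (Finset.card_image_le.trans ?_)
  · rw [Int.card_Icc]; omega
  · simp

instance (n l : ℕ) : FiniteDimensional F (onsagerSpan F A G n l) :=
  FiniteDimensional.span_of_finite F
    (((Set.finite_Icc _ _).image _).union ((Set.finite_Iio l).image _))

/-- The index window is symmetric about 1/2, the midpoint of 0 and 1. Bracketing with A 0 or A 1
exchanges the two kinds of vector: an A m in the window yields G of index at most n + 1, and G of
index at most l yields A's of index between -l and l + 1. Keeping the two parameters independent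
records this half-step growth. -/
theorem lie_mem_onsagerSpan (hA : ∀ (n : ℕ) m, ⁅A (m + n), A m⁆ = (2 : F) • G n)
    (hG : ∀ (n : ℕ) m, ⁅G n, A m⁆ = A (m + n) - A (m - n)) {n l n' l' : ℕ} (hn : l ≤ n')
    (hl : n + 1 ≤ l') {c : ℤ} (hc : c = 0 ∨ c = 1) {u : L} (hu : u ∈ onsagerSpan F A G n l) :
    ⁅A c, u⁆ ∈ onsagerSpan F A G n' l' := by
  induction hu using Submodule.span_induction with
  | zero => rw [lie_zero]; exact Submodule.zero_mem _
  | add u v _ _ hu hv => rw [lie_add]; exact Submodule.add_mem _ hu hv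
  | smul r u _ hu => rw [lie_smul]; exact Submodule.smul_mem _ r hu
  | mem u hu =>
    rcases hu with ⟨m, ⟨h1, h2⟩, rfl⟩ | ⟨i, hi, rfl⟩
    · rcases lt_trichotomy m c with h | rfl | h
      · obtain ⟨j, hj⟩ : ∃ j : ℕ, c = m + ((j + 1 : ℕ) : ℤ) := ⟨(c - m - 1).toNat, by omega⟩
        rw [hj, hA]
        exact Submodule.smul_mem _ _ (mem_onsagerSpan_G (by omega))
      · rw [lie_self]; exact Submodule.zero_mem _
      · obtain ⟨j, hj⟩ : ∃ j : ℕ, m = c + ((j + 1 : ℕ) : ℤ) := ⟨(m - c - 1).toNat, by omega⟩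
        rw [hj, ← lie_skew, hA]
        exact Submodule.neg_mem _ (Submodule.smul_mem _ _ (mem_onsagerSpan_G (by omega)))
    · have hi' : i < l := hi
      dsimp only
      rw [← lie_skew, hG]
      exact Submodule.neg_mem _ (Submodule.sub_mem _
        (mem_onsagerSpan_A (by push_cast; omega) (by push_cast; omega))
        (mem_onsagerSpan_A (by push_cast; omega) (by push_cast; omega)))

/-- The Onsager algebra is the union of the spaces `onsagerSpan`. -/
theorem exists_mem_onsagerSpan {A : ℤ → O F} {G : ℕ → O F} (h0 : A 0 = genA F)
    (h1 : A 1 = genB F) (hA : ∀ (n : ℕ) m, ⁅A (m + n), A m⁆ = (2 : F) • G n)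
    (hG : ∀ (n : ℕ) m, ⁅G n, A m⁆ = A (m + n) - A (m - n)) (u : O F) :
    ∃ n, u ∈ onsagerSpan F A G n (n + 1) := by
  let S : Submodule F (O F) := ⨆ n, onsagerSpan F A G n (n + 1)
  have hmono : Monotone fun n => onsagerSpan F A G n (n + 1) :=
    fun n m h => onsagerSpan_mono h (by omega)
  have mem : ∀ u, u ∈ S ↔ ∃ n, u ∈ onsagerSpan F A G n (n + 1) := fun u =>
    Submodule.mem_iSup_of_directed _ hmono.directed_le
  rw [← mem]
  have hS : S = ⊤ := by
    apply PresentedLie.eq_top_of_lie_gen_mem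
    · refine Fin.forall_fin_two.2 ⟨(mem _).2 ⟨0, ?_⟩, (mem _).2 ⟨0, ?_⟩⟩
      · change genA F ∈ _
        rw [← h0]; exact mem_onsagerSpan_A (by simp) (by simp)
      · change genB F ∈ _
        rw [← h1]; exact mem_onsagerSpan_A (by simp) (by simp)
    · refine Fin.forall_fin_two.2 ⟨fun u hu => ?_, fun u hu => ?_⟩
      all_goals obtain ⟨n, hn⟩ := (mem u).1 hu
      · change ⁅genA F, u⁆ ∈ S
        rw [← h0]
        exact (mem _).2 ⟨n + 1, lie_mem_onsagerSpan hA hG le_rfl (by omega) (Or.inl rfl) hn⟩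
      · change ⁅genB F, u⁆ ∈ S
        rw [← h1]
        exact (mem _).2 ⟨n + 1, lie_mem_onsagerSpan hA hG le_rfl (by omega) (Or.inr rfl) hn⟩
  rw [hS]
  exact Submodule.mem_top

end Filtration

/-! ### Brackets and linear independence in the loop algebra -/

section LoopAlgebra

variable (F : Type*) [Field F]

theorem comb_sub (a b c a' b' c' : LoopRing F) :
    comb F a b c - comb F a' b' c' = comb F (a - a') (b - b') (c - c') := by
  rw [sub_eq_add_neg, comb_neg, comb_add]
  simp only [← sub_eq_add_neg]

/-- The element `elemPsi` in the coordinates of `comb`. -/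
theorem elemPsi_eq_comb (i : ℕ) : ∃ u : LoopRing F, -(t F : LoopRing F) * u = (-(t F : LoopRing F)) ^ i ∧
    elemPsi F i = comb F u 0 (-((t F - 1) * u)) := by
  -- The exponent is -1 when i = 0. Characterising this unit by its product with -t keeps integer
  -- powers out of the bracket computations.
  refine ⟨(((-(t F)) ^ ((i : ℤ) - 1) : (LoopRing F)ˣ) : LoopRing F), ?_, ?_⟩
  · rw [← Units.val_neg, ← Units.val_mul, ← zpow_one_add, add_sub_cancel, zpow_natCast,
      Units.val_pow_eq_pow_val]
  · rw [elemPsi, tens_eqX, tens_eqZ, comb_sub, comb_smul]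
    apply comb_congr <;> ring

theorem elemPsi_succ (i : ℕ) : elemPsi F (i + 1) =
    comb F ((-(t F : LoopRing F)) ^ i) 0 (-((t F - 1) * (-(t F : LoopRing F)) ^ i)) := by
  rw [elemPsi, tens_eqX, tens_eqZ, comb_sub, comb_smul]
  simp only [Nat.cast_add, Nat.cast_one, add_sub_cancel_right, zpow_natCast,
    Units.val_pow_eq_pow_val, Units.val_neg]
  apply comb_congr <;> ring

theorem elemA_eq_comb (i : ℕ) : elemA F i = comb F ((-(t F : LoopRing F)) ^ i) 0 0 := by
  rw [elemA, tens_eqX]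

theorem elemB_eq_comb (i : ℕ) : elemB F i =
    comb F 0 (-(t F * (-(t F : LoopRing F)) ^ i)) (-((t F - 1) * (-(t F : LoopRing F)) ^ i)) := by
  rw [elemB, tens_eqY, tens_eqZ, comb_neg, comb_sub, comb_smul]
  apply comb_congr <;> ring

theorem comb_zero : comb F 0 0 0 = 0 := by
  have := comb_smul F 0 0 0 0
  rwa [zero_smul, mul_zero, eq_comm] at this

theorem lie_elemA_elemA (i j : ℕ) : ⁅elemA F i, elemA F j⁆ = 0 := by
  rw [elemA_eq_comb, elemA_eq_comb, lie_comb, ← comb_zero]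
  apply comb_congr <;> ring

theorem lie_elemB_elemB (i j : ℕ) : ⁅elemB F i, elemB F j⁆ = 0 := by
  rw [elemB_eq_comb, elemB_eq_comb, lie_comb, ← comb_zero]
  apply comb_congr <;> ring

theorem lie_elemPsi_elemPsi (i j : ℕ) : ⁅elemPsi F i, elemPsi F j⁆ = 0 := by
  obtain ⟨u, -, hu⟩ := elemPsi_eq_comb F i
  obtain ⟨v, -, hv⟩ := elemPsi_eq_comb F j
  rw [hu, hv, lie_comb, ← comb_zero]
  apply comb_congr <;> ring

theorem neg_t_mul_left_cancel {u v : LoopRing F}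
    (h : -(t F : LoopRing F) * u = -(t F : LoopRing F) * v) : u = v := by
  rw [neg_mul, neg_mul, neg_inj] at h
  exact (t F).isUnit.mul_left_cancel h

theorem lie_elemPsi_elemA (i j : ℕ) : ⁅elemPsi F i, elemA F j⁆ =
    (2 : F) • elemPsi F (i + j) + (2 : F) • elemA F (i + j) := by
  obtain ⟨u, hu, hu'⟩ := elemPsi_eq_comb F i
  obtain ⟨v, hv, hv'⟩ := elemPsi_eq_comb F (i + j)
  have huv : v = u * (-(t F : LoopRing F)) ^ j :=
    neg_t_mul_left_cancel F (by rw [hv, ← mul_assoc, hu, pow_add])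
  rw [hu', hv', elemA_eq_comb, elemA_eq_comb, lie_comb, comb_two, comb_two, comb_add, pow_add,
    ← hu, huv]
  apply comb_congr <;> ring

theorem lie_elemB_elemPsi (i j : ℕ) : ⁅elemB F i, elemPsi F j⁆ =
    (2 : F) • elemB F (i + j) + (2 : F) • elemPsi F (i + j) := by
  obtain ⟨u, hu, hu'⟩ := elemPsi_eq_comb F j
  obtain ⟨v, hv, hv'⟩ := elemPsi_eq_comb F (i + j)
  have huv : v = u * (-(t F : LoopRing F)) ^ i :=
    neg_t_mul_left_cancel F (by rw [hv, ← mul_assoc, hu, pow_add, mul_comm])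
  rw [hu', hv', elemB_eq_comb, elemB_eq_comb, lie_comb, comb_two, comb_two, comb_add, pow_add,
    ← hu, huv]
  apply comb_congr <;> ring

theorem lie_elemA_elemB (i j : ℕ) : ⁅elemA F i, elemB F j⁆ =
    (2 : F) • elemA F (i + j) + (2 : F) • elemB F (i + j) - (4 : F) • elemPsi F (i + j + 1) := by
  rw [elemPsi_succ, elemA_eq_comb, elemA_eq_comb, elemB_eq_comb, elemB_eq_comb, lie_comb,
    comb_two, comb_two, comb_four, comb_add, comb_sub, pow_add]
  apply comb_congr <;> ring

variable {F}

/-- The coordinate of the loop algebra attached to a linear form on `sl₂`. -/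
def coord (φ : Sl2 F →ₗ[F] F) : Loop F →ₗ[F] LoopRing F :=
  (TensorProduct.rid F (LoopRing F)).toLinearMap ∘ₗ
    (LinearMap.lTensor (LoopRing F) φ : LoopRing F ⊗[F] Sl2 F →ₗ[F] LoopRing F ⊗[F] F)

theorem coord_tens (φ : Sl2 F →ₗ[F] F) (u : Sl2 F) (a : LoopRing F) :
    coord φ (tens u a) = φ u • a :=
  rfl

/-- A matrix entry as a linear form on `sl₂`. -/
def entry (F : Type*) [Field F] (i j : Fin 2) : Sl2 F →ₗ[F] F :=
  Matrix.entryLinearMap F F i j ∘ₗ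
    (LieAlgebra.SpecialLinear.sl (Fin 2) F : Submodule F (Matrix (Fin 2) (Fin 2) F)).subtype

/-- Used to read off coordinates of `comb F a b c`: its (0,1), (1,0) and (0,0) entries are 2a, -2b
and c - a - b. -/
theorem entry_apply (i j : Fin 2) (u : Sl2 F) : entry F i j u = u.1 i j := rfl

theorem comb_eq_zero [CharZero F] {a b c : LoopRing F} (hc : comb F a b c = 0) :
    a = 0 ∧ b = 0 ∧ c = 0 := by
  have h01 := congrArg (coord (entry F 0 1)) hc
  have h10 := congrArg (coord (entry F 1 0)) hc
  have h00 := congrArg (coord (entry F 0 0)) hc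
  simp only [comb, map_add, coord_tens, map_zero] at h01 h10 h00
  simp [entry_apply, eqX, eqY, eqZ, e, f, h] at h01 h10 h00
  subst h01 h10
  simpa using h00

theorem algebraMap_injective : Function.Injective (algebraMap F[X] (LoopRing F)) :=
  IsLocalization.injective (M := Submonoid.powers (Polynomial.X * (Polynomial.X - 1) : F[X])) _
    (powers_le_nonZeroDivisors_of_noZeroDivisors
      (mul_ne_zero Polynomial.X_ne_zero (Polynomial.X_sub_C_ne_zero (1 : F))))

/-- Evaluation at -t is the involution X ↦ -X of F[X] followed by the localization map, which is
injective because X(X - 1) is nonzero in a domain. -/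
theorem aeval_neg_t_injective :
    Function.Injective (Polynomial.aeval (-(t F : LoopRing F)) : F[X] → LoopRing F) := by
  intro p q hpq
  have key : ∀ p : F[X], Polynomial.aeval (-(t F : LoopRing F)) p =
      algebraMap F[X] (LoopRing F) (p.comp (-Polynomial.X)) := by
    intro p
    rw [show -(t F : LoopRing F) = algebraMap F[X] (LoopRing F) (-Polynomial.X) by
      rw [map_neg]; rfl, Polynomial.aeval_algebraMap_apply]
    rfl
  rw [key, key] at hpq
  have := congrArg (fun r => r.comp (-Polynomial.X)) (algebraMap_injective hpq)
  simpa only [Polynomial.comp_neg_X_comp_neg_X] using this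

/-- The elements of the basis as a single family. -/
def elem (F : Type*) [Field F] : ℕ ⊕ ℕ ⊕ ℕ → Loop F :=
  Sum.elim (elemA F) (Sum.elim (elemB F) fun i => elemPsi F (i + 1))

/-- The linear map `(p, q, r) ↦ x ⊗ p(-t) + (-y ⊗ t - z ⊗ (t - 1)) q(-t) + (x - z ⊗ (t - 1)) r(-t)`. -/
def combPoly (F : Type*) [Field F] : F[X] × F[X] × F[X] →ₗ[F] Loop F where
  toFun p := comb F
    (Polynomial.aeval (-(t F : LoopRing F)) (p.1 + p.2.2))
    (-(t F * Polynomial.aeval (-(t F : LoopRing F)) p.2.1))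
    (-((t F - 1) * Polynomial.aeval (-(t F : LoopRing F)) (p.2.1 + p.2.2)))
  map_add' p q := by
    rw [comb_add]
    apply comb_congr <;> simp only [Prod.fst_add, Prod.snd_add, map_add] <;> ring
  map_smul' c p := by
    rw [RingHom.id_apply, ← algebraMap_smul (LoopRing F) c (comb F _ _ _), comb_smul]
    apply comb_congr <;>
      simp only [Prod.smul_fst, Prod.smul_snd, ← smul_add, map_smul] <;>
      simp only [Algebra.smul_def] <;> ring

/-- Since t and t - 1 are units, vanishing of the three coordinates forces p + r = q = q + r = 0. -/
theorem combPoly_injective [CharZero F] : Function.Injective (combPoly F) := by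
  rw [← LinearMap.ker_eq_bot, LinearMap.ker_eq_bot']
  rintro ⟨p, q, r⟩ h
  obtain ⟨h1, h2, h3⟩ := comb_eq_zero h
  have ht : IsUnit ((t F : LoopRing F) - 1) := by
    have := (isUnit_one_sub_t F).neg
    rwa [neg_sub] at this
  rw [neg_eq_zero, (t F).isUnit.mul_right_eq_zero] at h2
  rw [neg_eq_zero, ht.mul_right_eq_zero] at h3
  have e1 := (map_eq_zero_iff _ aeval_neg_t_injective).1 h1
  have e2 := (map_eq_zero_iff _ aeval_neg_t_injective).1 h2
  have e3 := (map_eq_zero_iff _ aeval_neg_t_injective).1 h3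
  dsimp only at e1 e2 e3
  subst e2
  rw [zero_add] at e3
  subst e3
  rw [add_zero] at e1
  subst e1
  rfl

theorem linearIndependent_elem [CharZero F] : LinearIndependent F (elem F) := by
  let b := (Polynomial.basisMonomials F).prod
    ((Polynomial.basisMonomials F).prod (Polynomial.basisMonomials F))
  have hb : elem F = combPoly F ∘ b := by
    funext i
    rcases i with i | i | i
    · simp [b, elem, combPoly, elemA_eq_comb, Polynomial.aeval_monomial]
    · simp [b, elem, combPoly, elemB_eq_comb, Polynomial.aeval_monomial]
    · simp [b, elem, combPoly, elemPsi_succ, Polynomial.aeval_monomial]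
  rw [hb]
  exact b.linearIndependent.map' (combPoly F) (LinearMap.ker_eq_bot.2 combPoly_injective)

end LoopAlgebra

/-! ### Lifting the basis to the Onsager algebra, and injectivity -/

section Basis

variable (F : Type*) [Field F]

/-- The elements of `O` that correspond to `elemA F j`, `elemB F j` and `elemPsi F (j + 1)`. -/
def onsagerSeq : ℕ → O F × O F × O F
  | 0 => (genA F, -genB F,
      (1/4 : F) • ((2 : F) • genA F + (2 : F) • -genB F - ⁅genA F, -genB F⁆))
  | j + 1 =>
    let p := (onsagerSeq j).2.2
    let a := (1/2 : F) • ⁅p, genA F⁆ - p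
    let b := (1/2 : F) • ⁅-genB F, p⁆ - p
    (a, b, (1/4 : F) • ((2 : F) • a + (2 : F) • b - ⁅genA F, b⁆))

/-- The element of `O` that corresponds to `elemA F j`. -/
def seqA (j : ℕ) : O F := (onsagerSeq F j).1

/-- The element of `O` that corresponds to `elemB F j`. -/
def seqB (j : ℕ) : O F := (onsagerSeq F j).2.1

/-- The element of `O` that corresponds to `elemPsi F (j + 1)`. -/
def seqPsi (j : ℕ) : O F := (onsagerSeq F j).2.2

theorem seqPsi_eq (j : ℕ) : seqPsi F j =
    (1/4 : F) • ((2 : F) • seqA F j + (2 : F) • seqB F j - ⁅genA F, seqB F j⁆) := by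
  cases j <;> rfl

theorem seqA_succ (j : ℕ) :
    seqA F (j + 1) = (1/2 : F) • ⁅seqPsi F j, genA F⁆ - seqPsi F j := rfl

theorem seqB_succ (j : ℕ) :
    seqB F (j + 1) = (1/2 : F) • ⁅-genB F, seqPsi F j⁆ - seqPsi F j := rfl

theorem toLoop_genA_eq : toLoop F (genA F) = elemA F 0 := by
  rw [toLoop_genA, elemA, pow_zero]

theorem toLoop_neg_genB_eq : toLoop F (-genB F) = elemB F 0 := by
  rw [map_neg, toLoop_genB, elemB, pow_zero, one_smul]
  abel

variable {F} in
-- Each stage of the recursion brackets with a generator twice: once to reach the next A and B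
-- terms, widening the A window, and once to reach the ψ term, raising the G bound. This is the
-- containment needed for the dimension count.
theorem seq_mem_onsagerSpan {A : ℤ → O F} {G : ℕ → O F} (h0 : A 0 = genA F) (h1 : A 1 = genB F)
    (hA : ∀ (n : ℕ) m, ⁅A (m + n), A m⁆ = (2 : F) • G n)
    (hG : ∀ (n : ℕ) m, ⁅G n, A m⁆ = A (m + n) - A (m - n)) (j : ℕ) :
    seqA F j ∈ onsagerSpan F A G j j ∧ seqB F j ∈ onsagerSpan F A G j j ∧
      seqPsi F j ∈ onsagerSpan F A G j (j + 1) := by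
  have psi : ∀ j, seqA F j ∈ onsagerSpan F A G j j → seqB F j ∈ onsagerSpan F A G j j →
      seqPsi F j ∈ onsagerSpan F A G j (j + 1) := by
    intro j ha hb
    have hle : onsagerSpan F A G j j ≤ onsagerSpan F A G j (j + 1) :=
      onsagerSpan_mono le_rfl (Nat.le_succ j)
    rw [seqPsi_eq, ← h0]
    exact Submodule.smul_mem _ _ (Submodule.sub_mem _
      (Submodule.add_mem _ (Submodule.smul_mem _ _ (hle ha)) (Submodule.smul_mem _ _ (hle hb)))
      (lie_mem_onsagerSpan hA hG le_rfl le_rfl (Or.inl rfl) hb))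
  induction j with
  | zero =>
    have ha : seqA F 0 ∈ onsagerSpan F A G 0 0 := by
      change genA F ∈ _
      rw [← h0]
      exact mem_onsagerSpan_A (by simp) (by simp)
    have hb : seqB F 0 ∈ onsagerSpan F A G 0 0 := by
      change -genB F ∈ _
      rw [← h1]
      exact Submodule.neg_mem _ (mem_onsagerSpan_A (by simp) (by simp))
    exact ⟨ha, hb, psi 0 ha hb⟩
  | succ j ih =>
    obtain ⟨-, -, hp⟩ := ih
    have hp' : seqPsi F j ∈ onsagerSpan F A G (j + 1) (j + 1) :=
      onsagerSpan_mono (Nat.le_succ j) le_rfl hp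
    have hl : ∀ c : ℤ, c = 0 ∨ c = 1 →
        ⁅A c, seqPsi F j⁆ ∈ onsagerSpan F A G (j + 1) (j + 1) := fun c hc =>
      lie_mem_onsagerSpan hA hG le_rfl le_rfl hc hp
    have ha : seqA F (j + 1) ∈ onsagerSpan F A G (j + 1) (j + 1) := by
      rw [seqA_succ, ← h0, ← lie_skew]
      exact Submodule.sub_mem _
        (Submodule.smul_mem _ _ (Submodule.neg_mem _ (hl 0 (Or.inl rfl)))) hp'
    have hb : seqB F (j + 1) ∈ onsagerSpan F A G (j + 1) (j + 1) := by
      rw [seqB_succ, ← h1, neg_lie]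
      exact Submodule.sub_mem _
        (Submodule.smul_mem _ _ (Submodule.neg_mem _ (hl 1 (Or.inr rfl)))) hp'
    exact ⟨ha, hb, psi _ ha hb⟩

variable [CharZero F]

/-- The recursion is three loop bracket formulas solved for their top-index term: [ψ, A 0] gives the
next A, [B 0, ψ] the next B, and [A 0, B] the next ψ. -/
theorem toLoop_seq (j : ℕ) : toLoop F (seqA F j) = elemA F j ∧
    toLoop F (seqB F j) = elemB F j ∧ toLoop F (seqPsi F j) = elemPsi F (j + 1) := by
  have psi : ∀ j, toLoop F (seqA F j) = elemA F j → toLoop F (seqB F j) = elemB F j →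
      toLoop F (seqPsi F j) = elemPsi F (j + 1) := by
    intro j hA hB
    rw [seqPsi_eq, map_smul, map_sub, map_add, map_smul, map_smul, LieHom.map_lie, hA, hB,
      toLoop_genA_eq, lie_elemA_elemB, zero_add]
    module
  induction j with
  | zero => exact ⟨toLoop_genA_eq F, toLoop_neg_genB_eq F,
      psi 0 (toLoop_genA_eq F) (toLoop_neg_genB_eq F)⟩
  | succ j ih =>
    obtain ⟨-, -, hP⟩ := ih
    have hA : toLoop F (seqA F (j + 1)) = elemA F (j + 1) := by
      rw [seqA_succ, map_sub, map_smul, LieHom.map_lie, hP, toLoop_genA_eq, lie_elemPsi_elemA,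
        add_zero]
      module
    have hB : toLoop F (seqB F (j + 1)) = elemB F (j + 1) := by
      rw [seqB_succ, map_sub, map_smul, LieHom.map_lie, hP, toLoop_neg_genB_eq, lie_elemB_elemPsi,
        zero_add]
      module
    exact ⟨hA, hB, psi _ hA hB⟩

theorem toLoop_seqA (j : ℕ) : toLoop F (seqA F j) = elemA F j := (toLoop_seq F j).1

theorem toLoop_seqB (j : ℕ) : toLoop F (seqB F j) = elemB F j := (toLoop_seq F j).2.1

theorem toLoop_seqPsi (j : ℕ) : toLoop F (seqPsi F j) = elemPsi F (j + 1) := (toLoop_seq F j).2.2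

/-- The basis vectors of `O` as a single family. -/
def seq (F : Type*) [Field F] : ℕ ⊕ ℕ ⊕ ℕ → O F :=
  Sum.elim (seqA F) (Sum.elim (seqB F) (seqPsi F))

theorem toLoop_seq_eq_elem (i : ℕ ⊕ ℕ ⊕ ℕ) : toLoop F (seq F i) = elem F i := by
  rcases i with i | i | i
  · exact toLoop_seqA F i
  · exact toLoop_seqB F i
  · exact toLoop_seqPsi F i

theorem linearIndependent_seq : LinearIndependent F (seq F) := by
  refine LinearIndependent.of_comp (toLoop F : O F →ₗ[F] Loop F) ?_
  convert linearIndependent_elem (F := F) using 1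
  funext i
  exact toLoop_seq_eq_elem F i

/-- A dimension count: the 3(n + 1) independent vectors of index at most n lie in `onsagerSpan F A G
n (n + 1)`, whose dimension is at most (2n + 2) + (n + 1), so they fill it. These spaces exhaust
`O`. -/
theorem span_seq : Submodule.span F (Set.range (seq F)) = ⊤ := by
  obtain ⟨A, k, h0, h1, hk, hkA⟩ := exists_onsager_family F
  let G : ℕ → O F := fun n => (1/2 : F) • ⁅A n, A 0⁆
  have hG0 : ∀ n : ℕ, ⁅A n, A 0⁆ = (2 : F) • G n := fun n => by
    simp only [G]
    module
  have hA : ∀ (n : ℕ) m, ⁅A (m + n), A m⁆ = (2 : F) • G n := fun n =>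
    (onsager_brackets hk hkA hG0 n).1
  have hG : ∀ (n : ℕ) m, ⁅G n, A m⁆ = A (m + n) - A (m - n) := fun n =>
    (onsager_brackets hk hkA hG0 n).2
  rw [eq_top_iff]
  intro u _
  obtain ⟨n, hn⟩ := exists_mem_onsagerSpan h0 h1 hA hG u
  let φ : Fin (n + 1) ⊕ Fin (n + 1) ⊕ Fin (n + 1) → ℕ ⊕ ℕ ⊕ ℕ :=
    Sum.map Fin.val (Sum.map Fin.val Fin.val)
  have hφ : Function.Injective φ := Fin.val_injective.sumMap
    (Fin.val_injective.sumMap Fin.val_injective)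
  have hind := (linearIndependent_seq F).comp φ hφ
  have hle : Submodule.span F (Set.range (seq F ∘ φ)) ≤ onsagerSpan F A G n (n + 1) := by
    rw [Submodule.span_le]
    have mem := seq_mem_onsagerSpan h0 h1 hA hG
    rintro _ ⟨j | j | j, rfl⟩
    · exact onsagerSpan_mono (by omega) (by omega) (mem j).1
    · exact onsagerSpan_mono (by omega) (by omega) (mem j).2.1
    · exact onsagerSpan_mono (by omega) (by omega) (mem j).2.2
  have heq := Submodule.eq_of_le_of_finrank_le hle (by
    rw [finrank_span_eq_card hind]
    refine (finrank_onsagerSpan_le n (n + 1)).trans ?_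
    simp only [Fintype.card_sum, Fintype.card_fin]
    omega)
  rw [← heq] at hn
  exact Submodule.span_mono (Set.range_comp_subset_range φ (seq F)) hn

/-- The basis of `O`. -/
def seqBasis : Module.Basis (ℕ ⊕ ℕ ⊕ ℕ) F (O F) :=
  Module.Basis.mk (linearIndependent_seq F) (span_seq F).ge

theorem seqBasis_apply (i : ℕ ⊕ ℕ ⊕ ℕ) : seqBasis F i = seq F i :=
  Module.Basis.mk_apply _ _ _

theorem toLoop_injective : Function.Injective (toLoop F) := by
  rw [injective_iff_map_eq_zero]
  intro u hu
  have h : Finsupp.linearCombination F (elem F) ((seqBasis F).repr u) = 0 := by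
    have e := Finsupp.apply_linearCombination F (toLoop F : O F →ₗ[F] Loop F) (seqBasis F)
      ((seqBasis F).repr u)
    rw [Module.Basis.linearCombination_repr] at e
    rw [← hu]
    refine Eq.trans ?_ e.symm
    congr 2
    funext i
    rw [Function.comp_apply, seqBasis_apply]
    exact (toLoop_seq_eq_elem F i).symm
  have := linearIndependent_iff.1 (linearIndependent_elem (F := F)) _ h
  rwa [LinearEquiv.map_eq_zero_iff] at this

end Basis

/-! ### The x_ij-like properties in the tetrahedron algebra -/

section Like

variable {F : Type*} [Field F]

/-- The quadratic form in `loopGen_eq_comb` equals 1 on every generator, so (ad)³ = 4 ad holds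
against every combination, not only against the opposite generator. -/
theorem lie_lie_lie_loopGen (i j : Fin 4) (hij : i ≠ j) (a b c : LoopRing F) :
    ⁅loopGen F i j, ⁅loopGen F i j, ⁅loopGen F i j, comb F a b c⁆⁆⁆ =
      (4 : F) • ⁅loopGen F i j, comb F a b c⁆ := by
  obtain ⟨a', b', c', h1, h2⟩ := loopGen_eq_comb F i j hij
  rw [h1]
  exact lie_lie_lie_comb F a' b' c' a b c h2

theorem x_skew (i j : Fin 4) (hij : i ≠ j) : x F j i hij.symm = -x F i j hij := by
  have := PresentedLie.mk_eq_zero (show _ ∈ {r | TetRel F r} from TetRel.skew i j hij)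
  rw [map_add] at this
  exact eq_neg_of_add_eq_zero_right this

theorem lie_x_x (i j k : Fin 4) (hij : i ≠ j) (hjk : j ≠ k) (hik : i ≠ k) :
    ⁅x F i j hij, x F j k hjk⁆ = (2 : F) • x F i j hij + (2 : F) • x F j k hjk := by
  have := PresentedLie.mk_eq_zero
    (show _ ∈ {r | TetRel F r} from TetRel.triple i j k hij hjk hik)
  simp only [map_sub, map_add, map_smul, LieHom.map_lie] at this
  exact sub_eq_zero.1 this

theorem toTet_neg_genB (F : Type*) [Field F] : toTet F (-genB F) = x F 3 0 (by decide) := by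
  rw [map_neg, toTet_genB, x_skew 0 3 (by decide)]

/-- The cubic condition is odd in x_kh and x_hk = -x_kh, so one ordering of the complementary pair
suffices. -/
theorem isLike_of {i j k h : Fin 4} (hij : i ≠ j) (hkh : k ≠ h) (hki : k ≠ i) (hkj : k ≠ j)
    (hhi : h ≠ i) (hhj : h ≠ j) {ξ : Tet F} (h1 : ⁅x F i j hij, ξ⁆ = 0)
    (h2 : ⁅x F k h hkh, ⁅x F k h hkh, ⁅x F k h hkh, ξ⁆⁆⁆ = (4 : F) • ⁅x F k h hkh, ξ⁆) :
    IsLike i j hij ξ := by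
  refine ⟨h1, fun h' k' hkh' hhi' hhj' hki' hkj' => ?_⟩
  have hcases : (k' = k ∧ h' = h) ∨ (k' = h ∧ h' = k) := by omega
  rcases hcases with ⟨rfl, rfl⟩ | ⟨rfl, rfl⟩
  · exact h2
  · rw [x_skew _ _ hkh]
    simp only [neg_lie, lie_neg, neg_neg, h2, smul_neg]

section Derivations

variable [CharZero F] {L : Type*} [LieRing L] [LieAlgebra F L] {a b p : ℕ → L}

/-- Here w, later x_01, acts as a term p (-1). If w commutes with p j, Leibniz on the recursion
gives its brackets with a (j + 1) and b (j + 1), and these force it to commute with p (j + 1). -/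
theorem lie_psi_eq_zero
    (ha : ∀ j, a (j + 1) = (1/2 : F) • ⁅p j, a 0⁆ - p j)
    (hb : ∀ j, b (j + 1) = (1/2 : F) • ⁅b 0, p j⁆ - p j)
    (hp : ∀ j, p j = (1/4 : F) • ((2 : F) • a j + (2 : F) • b j - ⁅a 0, b j⁆)) {w : L}
    (wa : ⁅w, a 0⁆ = (2 : F) • w + (2 : F) • a 0)
    (wb : ⁅w, b 0⁆ = -((2 : F) • b 0 + (2 : F) • w)) (j : ℕ) : ⁅w, p j⁆ = 0 := by
  have aw : ⁅a 0, w⁆ = -((2 : F) • w + (2 : F) • a 0) := by rw [← wa, lie_skew]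
  induction j with
  | zero =>
    have J := leibniz_lie w (a 0) (b 0)
    simp only [wa, wb, aw, add_lie, lie_add, lie_neg, lie_smul, smul_lie] at J
    rw [hp, lie_smul, lie_sub, lie_add, lie_smul, lie_smul, wa, wb, J]
    module
  | succ j ih =>
    have e1 : ⁅p j, a 0⁆ = (2 : F) • p j + (2 : F) • a (j + 1) := by rw [ha]; module
    have e2 : ⁅b 0, p j⁆ = (2 : F) • p j + (2 : F) • b (j + 1) := by rw [hb]; module
    have s : ⁅a 0, p j⁆ = -((2 : F) • p j + (2 : F) • a (j + 1)) := by rw [← e1, lie_skew]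
    have s' : ⁅p j, w⁆ = 0 := by rw [← lie_skew, ih, neg_zero]
    have Ja := leibniz_lie w (p j) (a 0)
    have Jb := leibniz_lie w (b 0) (p j)
    simp only [wa, wb, e1, e2, ih, s', add_lie, lie_add, neg_lie, lie_smul, smul_lie, zero_lie,
      lie_zero, smul_zero] at Ja Jb
    have wa' : ⁅w, a (j + 1)⁆ = (2 : F) • p j + (2 : F) • a (j + 1) := by
      linear_combination (norm := module) (1/2 : F) • Ja
    have wb' : ⁅w, b (j + 1)⁆ = -((2 : F) • p j + (2 : F) • b (j + 1)) := by
      linear_combination (norm := module) (1/2 : F) • Jb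
    have J := leibniz_lie w (a 0) (b (j + 1))
    simp only [wa, wb', s, add_lie, lie_add, lie_neg, lie_smul, smul_lie] at J
    rw [hp, lie_smul, lie_sub, lie_add, lie_smul, lie_smul, wa', wb', J]
    module

/-- With y later x_23, the induction needs companions c j to close the action of ad y; in the loop
model c j is y ⊗ (-t)^j. On the span of a j, b j, c j the action is explicit, and p j enters through
[y, p j] = 2 b j - 2 a j, an eigenvector of (ad y)² with eigenvalue 4. -/
theorem lie_lie_lie_psi
    (ha : ∀ j, a (j + 1) = (1/2 : F) • ⁅p j, a 0⁆ - p j)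
    (hb : ∀ j, b (j + 1) = (1/2 : F) • ⁅b 0, p j⁆ - p j)
    (hp : ∀ j, p j = (1/4 : F) • ((2 : F) • a j + (2 : F) • b j - ⁅a 0, b j⁆))
    (haa : ∀ j, ⁅a 0, a j⁆ = 0)
    (hbb : ∀ j, ⁅b 0, b j⁆ = 0)
    (hba : ∀ j, ⁅b 0, a j⁆ = (4 : F) • p j - (2 : F) • a j - (2 : F) • b j) {y : L}
    (ya : ⁅y, a 0⁆ = -((2 : F) • a 0 + (2 : F) • y))
    (yb : ⁅y, b 0⁆ = (2 : F) • y + (2 : F) • b 0) (j : ℕ) :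
    ⁅y, ⁅y, ⁅y, p j⁆⁆⁆ = (4 : F) • ⁅y, p j⁆ := by
  have hab : ∀ j, ⁅a 0, b j⁆ = (2 : F) • a j + (2 : F) • b j - (4 : F) • p j := fun j => by
    rw [hp]; module
  have yp : ∀ j (c : L), ⁅y, a j⁆ = -((2 : F) • a j + (2 : F) • c) →
      ⁅y, b j⁆ = (2 : F) • b j + (2 : F) • c → ⁅a 0, c⁆ = (2 : F) • a j + (2 : F) • c →
      ⁅y, p j⁆ = (2 : F) • b j - (2 : F) • a j := by
    intro j c h1 h2 h3
    have J := leibniz_lie y (a 0) (b j)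
    simp only [ya, h2, h3, add_lie, lie_add, neg_lie, lie_smul, smul_lie] at J
    rw [hp, lie_smul, lie_sub, lie_add, lie_smul, lie_smul, h1, h2, J]
    module
  have key : ∃ c, ⁅y, a j⁆ = -((2 : F) • a j + (2 : F) • c) ∧
      ⁅y, b j⁆ = (2 : F) • b j + (2 : F) • c ∧ ⁅a 0, c⁆ = (2 : F) • a j + (2 : F) • c ∧
      ⁅y, c⁆ = 0 := by
    induction j with
    | zero => exact ⟨y, ya, by rw [yb, add_comm], by rw [← lie_skew, ya, neg_neg], lie_self y⟩
    | succ j ih =>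
      obtain ⟨c, h1, h2, h3, -⟩ := ih
      have h4 := yp j c h1 h2 h3
      have e1 : ⁅p j, a 0⁆ = (2 : F) • p j + (2 : F) • a (j + 1) := by rw [ha]; module
      have e2 : ⁅b 0, p j⁆ = (2 : F) • p j + (2 : F) • b (j + 1) := by rw [hb]; module
      have e1' : ⁅a 0, p j⁆ = -((2 : F) • p j + (2 : F) • a (j + 1)) := by rw [← e1, lie_skew]
      have e3 : ⁅a j, a 0⁆ = 0 := by rw [← lie_skew, haa, neg_zero]
      have e4 : ⁅b j, a 0⁆ = -((2 : F) • a j + (2 : F) • b j - (4 : F) • p j) := by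
        rw [← hab, lie_skew]
      have e6 : ⁅p j, y⁆ = -((2 : F) • b j - (2 : F) • a j) := by rw [← h4, lie_skew]
      have Ja := leibniz_lie y (p j) (a 0)
      have Jb := leibniz_lie y (b 0) (p j)
      simp only [ya, yb, h4, e1, e2, e3, e4, e6, hbb, hba, sub_lie, add_lie, lie_sub, lie_add,
        lie_neg, lie_smul, smul_lie, smul_zero] at Ja Jb
      -- The next companion: in the loop model A_j + B_j - ψ_(j+1) = y ⊗ (-t)^(j+1).
      refine ⟨a j + b j - p j, ?_, ?_, ?_, ?_⟩
      · linear_combination (norm := module) (1/2 : F) • Ja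
      · linear_combination (norm := module) (1/2 : F) • Jb
      · rw [lie_sub, lie_add, haa, hab, e1']
        module
      · rw [lie_sub, lie_add, h1, h2, h4]
        module
  obtain ⟨c, h1, h2, h3, h4⟩ := key
  rw [yp j c h1 h2 h3]
  simp only [lie_sub, lie_add, lie_neg, lie_smul, h1, h2, h4]
  module

end Derivations

variable (F) [CharZero F]

theorem lie_genA_seqA (j : ℕ) : ⁅genA F, seqA F j⁆ = 0 := toLoop_injective F (by
  rw [LieHom.map_lie, toLoop_genA_eq, toLoop_seqA, lie_elemA_elemA, map_zero])

theorem lie_neg_genB_seqB (j : ℕ) : ⁅-genB F, seqB F j⁆ = 0 := toLoop_injective F (by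
  rw [LieHom.map_lie, toLoop_neg_genB_eq, toLoop_seqB, lie_elemB_elemB, map_zero])

theorem lie_neg_genB_seqA (j : ℕ) : ⁅-genB F, seqA F j⁆ =
    (4 : F) • seqPsi F j - (2 : F) • seqA F j - (2 : F) • seqB F j := toLoop_injective F (by
  rw [LieHom.map_lie, toLoop_neg_genB_eq, toLoop_seqA, ← lie_skew, lie_elemA_elemB]
  simp only [map_sub, map_smul, toLoop_seqA, toLoop_seqB, toLoop_seqPsi, add_zero]
  module)

theorem lie_lie_lie_genB_seqA (j : ℕ) : ⁅genB F, ⁅genB F, ⁅genB F, seqA F j⁆⁆⁆ =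
    (4 : F) • ⁅genB F, seqA F j⁆ := toLoop_injective F (by
  have hB : toLoop F (genB F) = loopGen F 0 3 := toLoop_genB F
  simp only [LieHom.map_lie, map_smul, hB, toLoop_seqA, elemA_eq_comb]
  exact lie_lie_lie_loopGen 0 3 (by decide) _ _ _)

theorem lie_lie_lie_genA_seqB (j : ℕ) : ⁅genA F, ⁅genA F, ⁅genA F, seqB F j⁆⁆⁆ =
    (4 : F) • ⁅genA F, seqB F j⁆ := toLoop_injective F (by
  have hA : toLoop F (genA F) = loopGen F 1 2 := toLoop_genA F
  simp only [LieHom.map_lie, map_smul, hA, toLoop_seqB, elemB_eq_comb]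
  exact lie_lie_lie_loopGen 1 2 (by decide) _ _ _)

theorem isLike_seqA (j : ℕ) : IsLike 1 2 (by decide) (toTet F (seqA F j)) := by
  refine isLike_of (k := 0) (h := 3) (by decide) (by decide) (by decide) (by decide) (by decide)
    (by decide) ?_ ?_
  · rw [← toTet_genA, ← LieHom.map_lie, lie_genA_seqA, map_zero]
  · rw [← toTet_genB]
    simp only [← LieHom.map_lie]
    rw [lie_lie_lie_genB_seqA, map_smul]

theorem isLike_seqB (j : ℕ) : IsLike 3 0 (by decide) (toTet F (seqB F j)) := by
  refine isLike_of (k := 1) (h := 2) (by decide) (by decide) (by decide) (by decide) (by decide)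
    (by decide) ?_ ?_
  · rw [← toTet_neg_genB, ← LieHom.map_lie, lie_neg_genB_seqB, map_zero]
  · rw [← toTet_genA]
    simp only [← LieHom.map_lie]
    rw [lie_lie_lie_genA_seqB, map_smul]

theorem isLike_seqPsi (j : ℕ) : IsLike 0 1 (by decide) (toTet F (seqPsi F j)) := by
  have hA : toTet F (seqA F 0) = x F 1 2 (by decide) := toTet_genA F
  have hB : toTet F (seqB F 0) = x F 3 0 (by decide) := toTet_neg_genB F
  have ha : ∀ j, toTet F (seqA F (j + 1)) =
      (1/2 : F) • ⁅toTet F (seqPsi F j), toTet F (seqA F 0)⁆ - toTet F (seqPsi F j) := fun j => by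
    rw [seqA_succ, map_sub, map_smul, LieHom.map_lie]; rfl
  have hb : ∀ j, toTet F (seqB F (j + 1)) =
      (1/2 : F) • ⁅toTet F (seqB F 0), toTet F (seqPsi F j)⁆ - toTet F (seqPsi F j) := fun j => by
    rw [seqB_succ, map_sub, map_smul, LieHom.map_lie]; rfl
  have hp : ∀ j, toTet F (seqPsi F j) =
      (1/4 : F) • ((2 : F) • toTet F (seqA F j) + (2 : F) • toTet F (seqB F j) -
        ⁅toTet F (seqA F 0), toTet F (seqB F j)⁆) := fun j => by
    rw [seqPsi_eq, map_smul, map_sub, map_add, map_smul, map_smul, LieHom.map_lie]; rfl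
  refine isLike_of (k := 2) (h := 3) (by decide) (by decide) (by decide) (by decide) (by decide)
    (by decide) ?_ ?_
  -- Here w = x_01; its brackets with x_12 and x_30 are triple relations.
  · refine lie_psi_eq_zero (a := fun j => toTet F (seqA F j)) (b := fun j => toTet F (seqB F j))
      (p := fun j => toTet F (seqPsi F j)) ha hb hp ?_ ?_ j
    · rw [hA]
      exact lie_x_x 0 1 2 _ _ (by decide)
    · rw [hB, ← lie_skew, lie_x_x 3 0 1 _ _ (by decide)]
  -- Here y = x_23. The brackets among the sequences are identities of `O`, already obtained from
  -- the loop algebra and now pushed forward by `toTet`.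
  · refine lie_lie_lie_psi (a := fun j => toTet F (seqA F j)) (b := fun j => toTet F (seqB F j))
      (p := fun j => toTet F (seqPsi F j)) ha hb hp (fun j => ?_) (fun j => ?_) (fun j => ?_)
      ?_ ?_ j
    · exact (LieHom.map_lie _ _ _).symm.trans
        ((congrArg (toTet F) (lie_genA_seqA F j)).trans (map_zero _))
    · exact (LieHom.map_lie _ _ _).symm.trans
        ((congrArg (toTet F) (lie_neg_genB_seqB F j)).trans (map_zero _))
    · refine (LieHom.map_lie _ _ _).symm.trans
        ((congrArg (toTet F) (lie_neg_genB_seqA F j)).trans ?_)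
      simp only [map_sub, map_smul]
    · rw [hA, ← lie_skew, lie_x_x 1 2 3 _ _ (by decide)]
    · rw [hB]
      exact lie_x_x 2 3 0 _ _ (by decide)

end Like

end Onsager

end

theorem mainTheorem6 (F : Type*) [Field F] [CharZero F] :
    -- the identification of `O` with a subalgebra of the loop algebra
    Function.Injective (Onsager.toLoop F) ∧
    -- the basis
    (∃ b : Module.Basis (ℕ ⊕ ℕ ⊕ ℕ) F (Onsager.O F),
      (∀ i : ℕ, Onsager.toLoop F (b (.inl i)) = Onsager.elemA F i) ∧
      (∀ i : ℕ, Onsager.toLoop F (b (.inr (.inl i))) = Onsager.elemB F i) ∧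
      (∀ i : ℕ, Onsager.toLoop F (b (.inr (.inr i))) = Onsager.elemPsi F (i + 1)) ∧
      b (.inl 0) = Onsager.genA F ∧
      b (.inr (.inl 0)) = -Onsager.genB F ∧
      (∀ i : ℕ, Onsager.IsLike 1 2 (by decide) (Onsager.toTet F (b (.inl i)))) ∧
      (∀ i : ℕ, Onsager.IsLike 3 0 (by decide) (Onsager.toTet F (b (.inr (.inl i))))) ∧
      (∀ i : ℕ, Onsager.IsLike 0 1 (by decide) (Onsager.toTet F (b (.inr (.inr i)))))) ∧
    -- the Lie bracket
    (∀ i j : ℕ, ⁅Onsager.elemA F i, Onsager.elemA F j⁆ = 0) ∧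
    (∀ i j : ℕ, ⁅Onsager.elemB F i, Onsager.elemB F j⁆ = 0) ∧
    (∀ i j : ℕ, ⁅Onsager.elemPsi F i, Onsager.elemPsi F j⁆ = 0) ∧
    (∀ i j : ℕ, ⁅Onsager.elemPsi F i, Onsager.elemA F j⁆ =
      (2 : F) • Onsager.elemPsi F (i + j) + (2 : F) • Onsager.elemA F (i + j)) ∧
    (∀ i j : ℕ, ⁅Onsager.elemB F i, Onsager.elemPsi F j⁆ =
      (2 : F) • Onsager.elemB F (i + j) + (2 : F) • Onsager.elemPsi F (i + j)) ∧
    (∀ i j : ℕ, ⁅Onsager.elemA F i, Onsager.elemB F j⁆ =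
      (2 : F) • Onsager.elemA F (i + j) + (2 : F) • Onsager.elemB F (i + j)
        - (4 : F) • Onsager.elemPsi F (i + j + 1)) := by
  refine ⟨Onsager.toLoop_injective F, ⟨Onsager.seqBasis F, ?_, ?_, ?_, ?_, ?_, ?_, ?_, ?_⟩,
    Onsager.lie_elemA_elemA F, Onsager.lie_elemB_elemB F, Onsager.lie_elemPsi_elemPsi F,
    Onsager.lie_elemPsi_elemA F, Onsager.lie_elemB_elemPsi F, Onsager.lie_elemA_elemB F⟩
  all_goals simp only [Onsager.seqBasis_apply]
  · exact Onsager.toLoop_seqA F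
  · exact Onsager.toLoop_seqB F
  · exact Onsager.toLoop_seqPsi F
  · rfl
  · rfl
  · exact Onsager.isLike_seqA F
  · exact Onsager.isLike_seqB F
  · exact Onsager.isLike_seqPsi F
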